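/- **Quadratic lifting in the Gaussian case.** Let $\mathbf S^n$ be the space of real symmetric $n\times n$ matrices, $\mathbf S^n_+$ the cone of positive semidefinite ones, and let $\succeq$ be the Löwner order. *Regular data and simple families.* Regular data $(\mathcal H,\mathcal M,\Phi)$ on an observation space $\Omega$ (a finite-dimensional real space whose linear forms $\langle h,\cdot\rangle$ are indexed by coefficient vectors $h$) consist of a nonempty closed convex set $\mathcal H$ of coefficient vectors symmetric with respect to the origin, a closed convex set $\mathcal M$ in a finite-dimensional space, and a continuous function $\Phi:\mathcal H\times\mathcal M\to\mathbb R$, convex in $h\in\mathcal H$ and concave in $\mu\in\mathcal M$. The simple family $\mathcal S[\mathcal H,\mathcal M,\Phi]$ consists of all Borel probability distributions $P$ on $\Omega$ for which there is $\mu\in\mathcal M$ such that $\ln\int_\Omega e^{\langle h,\omega\rangle}P(d\omega)\le\Phi(h;\mu)$ for all $h\in\mathcal H$ (in particular, these integrals are finite). For $\Omega=\mathbb R^d\times\mathbf S^d$ the linear form with coefficients $(h,H)\in\mathbb R^d\times\mathbf S^d$ is $(z,Z)\mapsto h^Tz+\tfrac12\mathrm{Tr}(HZ)$. *Assumptions.*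 Let $U\subset\mathbb R^m$ be nonempty and bounded, let $\mathcal U\subset\mathbf S^d_+$ be nonempty, convex and compact, let $\Theta_*\succ0$ satisfy $\Theta_*\succeq\Theta$ for all $\Theta\in\mathcal U$, let $A\in\mathbb R^{d\times(m+1)}$, and let $\delta\in[0,2]$ satisfy $\|\Theta^{1/2}\Theta_*^{-1/2}-I\|\le\delta$ (spectral norm) for all $\Theta\in\mathcal U$. Let $\gamma\in(0,1)$, and let $\mathcal Z\subset\{W\in\mathbf S^{m+1}_+:W_{m+1,m+1}=1\}$ be convex and compact and contain $[u;1][u;1]^T$ for every $u\in U$. Let $\phi_{\mathcal Z}(W)=\max_{Z\in\mathcal Z}\mathrm{Tr}(ZW)$, let $b=[0;\dots;0;1]\in\mathbb R^{m+1}$, and let $B=\begin{bmatrix}A\\ b^T\end{bmatrix}$. Put $$\mathcal H_\gamma=\{(h,H)\in\mathbb R^d\times\mathbf S^d:\ -\gamma\Theta_*^{-1}\preceq H\preceq\gamma\Theta_*^{-1}\},$$ $$\Gamma_{\mathcal Z}(h,H)=\tfrac12\phi_{\mathcal Z}\Big(bh^TA+A^Thb^T+A^THA+B^T[H,h]^T[\Theta_*^{-1}-H]^{-1}[H,h]B\Big),$$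 and, for $(h,H)\in\mathcal H_\gamma$ and $\Theta\in\mathcal U$, $$\Phi(h,H;\Theta)=-\tfrac12\ln\mathrm{Det}\big(I-\Theta_*^{1/2}H\Theta_*^{1/2}\big)+\tfrac12\mathrm{Tr}\big([\Theta-\Theta_*]H\big)+\frac{\delta(2-\delta)}{2(1-\gamma)}\big\|\Theta_*^{1/2}H\Theta_*^{1/2}\big\|_F^2+\Gamma_{\mathcal Z}(h,H),$$ where $\|\cdot\|_F$ is the Frobenius norm. *Claim.* 1. $(\mathcal H_\gamma,\mathcal U,\Phi)$ is regular data. 2. For all $u\in U$ and $\Theta\in\mathcal U$, the distribution of $(\zeta,\zeta\zeta^T)$ with $\zeta\sim\mathcal N(A[u;1],\Theta)$ belongs to $\mathcal S[\mathcal H_\gamma,\mathcal U,\Phi]$. 3. $\Phi$ is coercive in $(h,H)$: for every $\Theta\in\mathcal U$ and every sequence $(h_i,H_i)\in\mathcal H_\gamma$ with $\|(h_i,H_i)\|\to\infty$, one has $\Phi(h_i,H_i;\Theta)\to\infty$. -/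

import Mathlib

open MeasureTheory ProbabilityTheory Matrix Filter Topology
open scoped MatrixOrder

noncomputable section

/-! ### Regular data and simple families -/

/-- Regular data `(ℋ, ℳ, Φ)`: `ℋ` is a nonempty closed convex set symmetric with respect to the
origin, `ℳ` is a closed convex set, and `Φ : ℋ × ℳ → ℝ` is continuous, convex in `h ∈ ℋ` and concave
in `μ ∈ ℳ` (the values of `Φ` outside `ℋ × ℳ` are irrelevant). -/
structure IsRegularData {E F : Type*}
    [AddCommGroup E] [Module ℝ E] [TopologicalSpace E]
    [AddCommGroup F] [Module ℝ F] [TopologicalSpace F]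
    (ℋ : Set E) (ℳ : Set F) (Φ : E → F → ℝ) : Prop where
  nonempty : ℋ.Nonempty
  isClosed_left : IsClosed ℋ
  convex_left : Convex ℝ ℋ
  symmetric : ∀ h ∈ ℋ, -h ∈ ℋ
  isClosed_right : IsClosed ℳ
  convex_right : Convex ℝ ℳ
  continuousOn : ContinuousOn (fun p : E × F => Φ p.1 p.2) (ℋ ×ˢ ℳ)
  convexOn : ∀ μ ∈ ℳ, ConvexOn ℝ ℋ (fun h => Φ h μ)
  concaveOn : ∀ h ∈ ℋ, ConcaveOn ℝ ℳ (fun μ => Φ h μ)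

/-- The simple family `S[ℋ, ℳ, Φ]` of Borel probability distributions `P` on the observation
space `Ω`: for some `μ ∈ ℳ`, one has `ln (∫ exp ⟨h, ω⟩ P(dω)) ≤ Φ (h; μ)` for all `h ∈ ℋ`.
Here `ℓ h ω = ⟨h, ω⟩` is the bilinear form by which coefficient vectors `h` represent linear forms
on `Ω`. Finiteness of the integral is part of the requirement. -/
def simpleFamily {E F Ω : Type*} [AddCommGroup E] [Module ℝ E]
    [AddCommGroup Ω] [Module ℝ Ω] [TopologicalSpace Ω] [MeasurableSpace Ω] [BorelSpace Ω]
    (ℓ : E →ₗ[ℝ] Ω →ₗ[ℝ] ℝ) (ℋ : Set E) (ℳ : Set F) (Φ : E → F → ℝ) : Set (Measure Ω) :=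
  {P | IsProbabilityMeasure P ∧ ∃ μ ∈ ℳ, ∀ h ∈ ℋ,
    Integrable (fun ω => Real.exp (ℓ h ω)) P ∧
      Real.log (∫ ω, Real.exp (ℓ h ω) ∂P) ≤ Φ h μ}

/-! ### Symmetric matrices -/

/-- The space `𝐒ⁿ` of real symmetric matrices (with rows and columns indexed by `n`). -/
abbrev SymMat (n : Type*) : Type _ :=
  ↥({ carrier := {M : Matrix n n ℝ | M.IsSymm}
      add_mem' := fun ha hb => Matrix.IsSymm.add ha hb
      zero_mem' := Matrix.isSymm_zero
      smul_mem' := fun c _ hM => Matrix.IsSymm.smul hM c } : Submodule ℝ (Matrix n n ℝ))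

instance (n : Type*) : MeasurableSpace (SymMat n) := borel _

instance (n : Type*) : BorelSpace (SymMat n) := ⟨rfl⟩

instance (n : Type*) [Fintype n] : SecondCountableTopology (SymMat n) :=
  haveI : SecondCountableTopology (Matrix n n ℝ) :=
    inferInstanceAs (SecondCountableTopology (n → n → ℝ))
  TopologicalSpace.Subtype.secondCountableTopology _

/-- The Frobenius norm. -/
def frobNorm {n : Type*} [Fintype n] (M : Matrix n n ℝ) : ℝ :=
  √(∑ i, ∑ j, M i j ^ 2)

/-- The spectral norm. -/
def specNorm {n : Type*} [Fintype n] [DecidableEq n] (M : Matrix n n ℝ) : ℝ :=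
  ‖Matrix.toEuclideanCLM (𝕜 := ℝ) M‖

/-- The rank one matrix `v vᵀ`. -/
def outer {n : Type*} (v : n → ℝ) : SymMat n :=
  ⟨Matrix.vecMulVec v v, by
    ext i j
    simp [Matrix.vecMulVec_apply, mul_comm]⟩

/-! ### The Gaussian quadratic lifting

Coordinates in `ℝ^{m+1}` are indexed by `Fin m ⊕ Unit`, the last one being `Sum.inr ()`; similarly
for `ℝ^{d+1}`. -/

namespace GaussLift

variable {d m : ℕ}

/-- The space `ℝᵈ × 𝐒ᵈ`, both of observations `(z, Z)` and of coefficient vectors `(h, H)`. -/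
abbrev Obs (d : ℕ) : Type := EuclideanSpace ℝ (Fin d) × SymMat (Fin d)

/-- The linear form `hᵀz + ½ Tr(HZ)` with coefficients `(h, H)`, at the point `(z, Z)`. -/
def pairing (d : ℕ) : Obs d →ₗ[ℝ] Obs d →ₗ[ℝ] ℝ :=
  LinearMap.mk₂ ℝ
    (fun x ω => x.1.ofLp ⬝ᵥ ω.1.ofLp + (1 / 2) * Matrix.trace (x.2.1 * ω.2.1))
    (by
      intro x y ω
      simp only [Prod.fst_add, Prod.snd_add, WithLp.ofLp_add, Submodule.coe_add, add_dotProduct,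
        Matrix.add_mul, Matrix.trace_add]
      ring)
    (by
      intro c x ω
      simp only [Prod.smul_fst, Prod.smul_snd, WithLp.ofLp_smul, Submodule.coe_smul,
        smul_dotProduct, Matrix.smul_mul, Matrix.trace_smul, smul_eq_mul]
      ring)
    (by
      intro x ω η
      simp only [Prod.fst_add, Prod.snd_add, WithLp.ofLp_add, Submodule.coe_add, dotProduct_add,
        Matrix.mul_add, Matrix.trace_add]
      ring)
    (by
      intro c x ω
      simp only [Prod.smul_fst, Prod.smul_snd, WithLp.ofLp_smul, Submodule.coe_smul,
        dotProduct_smul, Matrix.mul_smul, Matrix.trace_smul, smul_eq_mul]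
      ring)

/-- The vector `[u; 1]`. -/
def aug (u : EuclideanSpace ℝ (Fin m)) : Fin m ⊕ Unit → ℝ :=
  Sum.elim u.ofLp (fun _ => 1)

/-- The last basic orth `b = [0; …; 0; 1]` of `ℝ^{m+1}`. -/
def lastOrth (m : ℕ) : Fin m ⊕ Unit → ℝ :=
  Sum.elim (fun _ => 0) (fun _ => 1)

/-- The affine mapping `u ↦ A[u; 1]`. -/
def affineMean (A : Matrix (Fin d) (Fin m ⊕ Unit) ℝ) (u : EuclideanSpace ℝ (Fin m)) :
    EuclideanSpace ℝ (Fin d) :=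
  WithLp.toLp 2 (A *ᵥ aug u)

/-- The distribution of `(ζ, ζζᵀ)` with `ζ ∼ N(A[u; 1], Θ)`. -/
def liftedLaw (A : Matrix (Fin d) (Fin m ⊕ Unit) ℝ) (u : EuclideanSpace ℝ (Fin m))
    (Θ : SymMat (Fin d)) : Measure (Obs d) :=
  (multivariateGaussian (affineMean A u) Θ.1).map (fun ζ => (ζ, outer ζ.ofLp))

/-- The family of the distributions of `(ζ, ζζᵀ)` with `ζ ∼ N(A[u; 1], Θ)`,
`(u, Θ) ∈ U × 𝒰`. -/
def liftedFamily (A : Matrix (Fin d) (Fin m ⊕ Unit) ℝ) (U : Set (EuclideanSpace ℝ (Fin m)))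
    (𝒰 : Set (SymMat (Fin d))) : Set (Measure (Obs d)) :=
  {P | ∃ u ∈ U, ∃ Θ ∈ 𝒰, P = liftedLaw A u Θ}

/-- The support function `φ_𝒵(W) = max_{Z ∈ 𝒵} Tr(ZW)`; the supremum is attained when `𝒵` is nonempty
and compact. -/
def supportFn {n : Type*} [Fintype n] (𝒵 : Set (SymMat n)) (W : Matrix n n ℝ) : ℝ :=
  sSup ((fun Z : SymMat n => Matrix.trace (Z.1 * W)) '' 𝒵)

/-- `B = [A; bᵀ]`. -/
def matB (A : Matrix (Fin d) (Fin m ⊕ Unit) ℝ) : Matrix (Fin d ⊕ Unit) (Fin m ⊕ Unit) ℝ :=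
  Matrix.fromRows A (Matrix.replicateRow Unit (lastOrth m))

/-- The `d × (d+1)` matrix `[H, h]`. -/
def matHh (x : Obs d) : Matrix (Fin d) (Fin d ⊕ Unit) ℝ :=
  Matrix.fromCols x.2.1 (Matrix.replicateCol Unit x.1.ofLp)

/-- The matrix `bhᵀA + Aᵀhbᵀ + AᵀHA + Bᵀ[H,h]ᵀ[Θ⋆⁻¹ - H]⁻¹[H,h]B`. -/
def matQ (A : Matrix (Fin d) (Fin m ⊕ Unit) ℝ) (Θs : Matrix (Fin d) (Fin d) ℝ) (x : Obs d) :
    Matrix (Fin m ⊕ Unit) (Fin m ⊕ Unit) ℝ :=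
  Matrix.vecMulVec (lastOrth m) x.1.ofLp * A + Aᵀ * Matrix.vecMulVec x.1.ofLp (lastOrth m)
    + Aᵀ * x.2.1 * A + (matB A)ᵀ * (matHh x)ᵀ * (Θs⁻¹ - x.2.1)⁻¹ * matHh x * matB A

/-- The second form of the same matrix,
`Bᵀ([H, h; hᵀ, 0] + [H,h]ᵀ[Θ⋆⁻¹ - H]⁻¹[H,h])B`. -/
theorem matQ_eq (A : Matrix (Fin d) (Fin m ⊕ Unit) ℝ) (Θs : Matrix (Fin d) (Fin d) ℝ)
    (x : Obs d) :
    matQ A Θs x = (matB A)ᵀ *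
      (Matrix.fromBlocks x.2.1 (Matrix.replicateCol Unit x.1.ofLp)
          (Matrix.replicateRow Unit x.1.ofLp) 0
        + (matHh x)ᵀ * (Θs⁻¹ - x.2.1)⁻¹ * matHh x) * matB A := by
  have h1 : (matB A)ᵀ * Matrix.fromBlocks x.2.1 (Matrix.replicateCol Unit x.1.ofLp)
          (Matrix.replicateRow Unit x.1.ofLp) 0 * matB A
      = Matrix.vecMulVec (lastOrth m) x.1.ofLp * A
        + Aᵀ * Matrix.vecMulVec x.1.ofLp (lastOrth m) + Aᵀ * x.2.1 * A := by
    rw [matB, Matrix.transpose_fromRows, Matrix.fromCols_mul_fromBlocks,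
      Matrix.fromCols_mul_fromRows]
    simp only [Matrix.transpose_replicateRow, Matrix.mul_zero, add_zero, Matrix.add_mul,
      Matrix.vecMulVec_eq Unit, Matrix.mul_assoc]
    abel
  rw [matQ, ← h1]
  simp only [Matrix.mul_add, Matrix.add_mul, Matrix.mul_assoc]

/-- `ℋ_γ = {(h, H) : -γ Θ⋆⁻¹ ⪯ H ⪯ γ Θ⋆⁻¹}`. -/
def setH (γ : ℝ) (Θs : Matrix (Fin d) (Fin d) ℝ) : Set (Obs d) :=
  {x | (x.2.1 - -(γ • Θs⁻¹)).PosSemidef ∧ (γ • Θs⁻¹ - x.2.1).PosSemidef}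

/-- `Γ_𝒵(h, H)`. -/
def gammaZ (A : Matrix (Fin d) (Fin m ⊕ Unit) ℝ) (Θs : Matrix (Fin d) (Fin d) ℝ)
    (𝒵 : Set (SymMat (Fin m ⊕ Unit))) (x : Obs d) : ℝ :=
  (1 / 2) * supportFn 𝒵 (matQ A Θs x)

/-- The function
`Φ(h, H; Θ) = -½ ln Det(I - Θ⋆^{1/2} H Θ⋆^{1/2}) + ½ Tr([Θ - Θ⋆]H)
  + δ(2-δ)/(2(1-γ)) ‖Θ⋆^{1/2} H Θ⋆^{1/2}‖_F² + Γ_𝒵(h, H)`. -/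
def Phi (A : Matrix (Fin d) (Fin m ⊕ Unit) ℝ) (Θs : Matrix (Fin d) (Fin d) ℝ)
    (𝒵 : Set (SymMat (Fin m ⊕ Unit))) (γ δ : ℝ) (x : Obs d) (Θ : SymMat (Fin d)) : ℝ :=
  -(1 / 2) * Real.log (1 - CFC.sqrt Θs * x.2.1 * CFC.sqrt Θs).det
    + (1 / 2) * Matrix.trace ((Θ.1 - Θs) * x.2.1)
    + δ * (2 - δ) / (2 * (1 - γ)) * frobNorm (CFC.sqrt Θs * x.2.1 * CFC.sqrt Θs) ^ 2
    + gammaZ A Θs 𝒵 x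

end GaussLift

end

/-! ### Positive semidefinite real matrices -/

section PosSemidef

variable {n : Type*} [Fintype n]

/-! Write D = Θ⋆ - Θ ⪰ 0, K = Θ⋆⁻¹ - H and q(ζ) = hᵀζ + ½ζᵀHζ.

Membership. N(μ, Θ⋆) is the law of ζ + ξ with ζ ∼ N(μ, Θ) and independent ξ ∼ N(0, D). Given ζ, the
mean of q(ζ + ξ) is q(ζ) + ½Tr(DH), so Jensen's inequality in ξ bounds the exponential moment under
Θ by exp(-½Tr(DH)) times the one under Θ⋆ (`lintegral_exp_quadratic_multivariateGaussian_le`). The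
latter is explicit: a determinant factor times the exponential of half the form of `matQ` at w = [u;
1], and Γ_𝒵 dominates that half form because wwᵀ ∈ 𝒵. The Frobenius term is nonnegative and only
increases Φ.

Convexity. The log-determinant term is the log-Laplace transform of a Gaussian quadratic form, hence
convex by Hölder. In Γ_𝒵 the nonlinear term is the matrix fractional function vᵀK⁻¹v = max over y of
(2yᵀv - yᵀKy), jointly convex as a maximum of affine functions of (v, K). Pairing with Z ⪰ 0 and
taking the supremum over 𝒵 preserve convexity. In Θ the function Φ is affine.

Coercivity. On ℋ_γ the matrix H is bounded, so only h can escape. The test vector y = th in the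
variational formula makes Γ_𝒵 grow quadratically in ‖h‖, while ln Det M ≤ Tr M - d controls the
determinant term. -/

theorem Matrix.dotProduct_mulVec_symm {M : Matrix n n ℝ} (hM : M.IsSymm) (x y : n → ℝ) :
    x ⬝ᵥ M *ᵥ y = y ⬝ᵥ M *ᵥ x := by
  rw [dotProduct_mulVec, ← mulVec_transpose, hM.eq, dotProduct_comm]

theorem Matrix.PosSemidef.real_dotProduct_nonneg {M : Matrix n n ℝ} (hM : M.PosSemidef)
    (x : n → ℝ) : 0 ≤ x ⬝ᵥ M *ᵥ x := by
  simpa using hM.dotProduct_mulVec_nonneg x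

theorem Matrix.PosSemidef.of_real_dotProduct_nonneg {M : Matrix n n ℝ} (hM : M.IsSymm)
    (h : ∀ x, 0 ≤ x ⬝ᵥ M *ᵥ x) : M.PosSemidef := by
  refine Matrix.PosSemidef.of_dotProduct_mulVec_nonneg ?_ (fun x => by simpa using h x)
  rw [Matrix.IsHermitian, Matrix.conjTranspose_eq_transpose_of_trivial, hM.eq]

/-- A lower bound for the quadratic form of the inverse of a positive definite matrix. -/
theorem Matrix.PosDef.le_dotProduct_inv_mulVec [DecidableEq n] {K : Matrix n n ℝ} (hK : K.PosDef)
    (v y : n → ℝ) : 2 * (y ⬝ᵥ v) - y ⬝ᵥ K *ᵥ y ≤ v ⬝ᵥ K⁻¹ *ᵥ v := by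
  have hdet : IsUnit K.det := (Matrix.isUnit_iff_isUnit_det K).1 hK.isUnit
  have hs : K.IsSymm := by
    have := hK.1
    rwa [Matrix.IsHermitian, Matrix.conjTranspose_eq_transpose_of_trivial] at this
  -- Completing the square: the gap in the inequality is the K-form at y - K⁻¹v.
  have h := hK.posSemidef.real_dotProduct_nonneg (y - K⁻¹ *ᵥ v)
  have e : K *ᵥ (K⁻¹ *ᵥ v) = v := by
    rw [mulVec_mulVec, Matrix.mul_nonsing_inv _ hdet, one_mulVec]
  have e2 : (K⁻¹ *ᵥ v) ⬝ᵥ K *ᵥ y = y ⬝ᵥ v := by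
    rw [Matrix.dotProduct_mulVec_symm hs, e]
  rw [mulVec_sub, e, sub_dotProduct, dotProduct_sub, dotProduct_sub, e2,
    dotProduct_comm (K⁻¹ *ᵥ v) v] at h
  linarith

/-- The preceding lower bound is attained at y = K⁻¹v. -/
theorem Matrix.PosDef.dotProduct_inv_mulVec_eq [DecidableEq n] {K : Matrix n n ℝ} (hK : K.PosDef)
    (v : n → ℝ) :
    v ⬝ᵥ K⁻¹ *ᵥ v = 2 * ((K⁻¹ *ᵥ v) ⬝ᵥ v) - (K⁻¹ *ᵥ v) ⬝ᵥ K *ᵥ (K⁻¹ *ᵥ v) := by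
  have hdet : IsUnit K.det := (Matrix.isUnit_iff_isUnit_det K).1 hK.isUnit
  rw [mulVec_mulVec, Matrix.mul_nonsing_inv _ hdet, one_mulVec, dotProduct_comm]
  ring

/-- Joint convexity of the matrix fractional function `(v, K) ↦ v ⬝ K⁻¹ v`. -/
theorem Matrix.PosDef.dotProduct_inv_mulVec_convex [DecidableEq n] {K L : Matrix n n ℝ}
    (hK : K.PosDef) (hL : L.PosDef) (v w : n → ℝ) {a b : ℝ} (ha : 0 ≤ a) (hb : 0 ≤ b)
    (hab : (a • K + b • L).PosDef) :
    (a • v + b • w) ⬝ᵥ (a • K + b • L)⁻¹ *ᵥ (a • v + b • w)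
      ≤ a * (v ⬝ᵥ K⁻¹ *ᵥ v) + b * (w ⬝ᵥ L⁻¹ *ᵥ w) := by
  rw [hab.dotProduct_inv_mulVec_eq]
  -- The maximizer for the combined data serves as a test vector for both (v, K) and (w, L).
  set y := (a • K + b • L)⁻¹ *ᵥ (a • v + b • w)
  have h1 := mul_le_mul_of_nonneg_left (hK.le_dotProduct_inv_mulVec v y) ha
  have h2 := mul_le_mul_of_nonneg_left (hL.le_dotProduct_inv_mulVec w y) hb
  simp only [dotProduct_add, dotProduct_smul, add_mulVec, smul_mulVec, smul_eq_mul]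
  linarith

/-- Polarization: adding the form of P + H at x + y to that of P - H at x - y isolates the cross
term of H; exchanging the signs gives the other bound. At basis vectors this bounds the entries of
H. -/
theorem Matrix.PosSemidef.abs_dotProduct_mulVec_le {P H : Matrix n n ℝ} (hH : H.IsSymm)
    (h1 : (P + H).PosSemidef) (h2 : (P - H).PosSemidef) (hP : P.IsSymm) (x y : n → ℝ) :
    |x ⬝ᵥ H *ᵥ y| ≤ (1 / 2) * (x ⬝ᵥ P *ᵥ x + y ⬝ᵥ P *ᵥ y) := by
  have a1 := h1.real_dotProduct_nonneg (x + y)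
  have a2 := h2.real_dotProduct_nonneg (x + y)
  have a3 := h1.real_dotProduct_nonneg (x - y)
  have a4 := h2.real_dotProduct_nonneg (x - y)
  simp only [add_mulVec, sub_mulVec, mulVec_add, mulVec_sub, dotProduct_add, dotProduct_sub,
    add_dotProduct, sub_dotProduct] at a1 a2 a3 a4
  rw [Matrix.dotProduct_mulVec_symm hH y x, Matrix.dotProduct_mulVec_symm hP y x] at *
  rw [abs_le]
  constructor <;> linarith

/-- Sum ln t ≤ t - 1 over the eigenvalues. -/
theorem Matrix.PosDef.log_det_le_trace [DecidableEq n] {M : Matrix n n ℝ} (hM : M.PosDef) :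
    Real.log M.det ≤ M.trace - Fintype.card n := by
  rw [hM.1.det_eq_prod_eigenvalues, hM.1.trace_eq_sum_eigenvalues]
  simp only [RCLike.ofReal_real_eq_id, id]
  rw [Real.log_prod (fun i _ => (hM.eigenvalues_pos i).ne')]
  calc _ ≤ ∑ i, (hM.1.eigenvalues i - 1) :=
        Finset.sum_le_sum fun i _ => Real.log_le_sub_one_of_pos (hM.eigenvalues_pos i)
    _ = _ := by simp

/-- With R = √Z, Tr(ZM) = Tr(RᵀMR) is the sum of the form of M over the columns of R. Only quadratic
forms enter, so M and N need not be symmetric. -/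
theorem Matrix.trace_mul_le_of_forall_dotProduct_le [DecidableEq n] {Z : Matrix n n ℝ}
    (hZ : Z.PosSemidef) {M N : Matrix n n ℝ} (h : ∀ w, w ⬝ᵥ M *ᵥ w ≤ w ⬝ᵥ N *ᵥ w) :
    (Z * M).trace ≤ (Z * N).trace := by
  have hR : CFC.sqrt Z * CFC.sqrt Z = Z := CFC.sqrt_mul_sqrt_self _ hZ.nonneg
  have hRs : (CFC.sqrt Z)ᵀ = CFC.sqrt Z := by
    have := (CFC.sqrt_nonneg Z).posSemidef.1
    rwa [Matrix.IsHermitian, Matrix.conjTranspose_eq_transpose_of_trivial] at this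
  have key : ∀ M : Matrix n n ℝ,
      (Z * M).trace = ∑ k, (CFC.sqrt Z).col k ⬝ᵥ M *ᵥ (CFC.sqrt Z).col k := by
    intro M
    have e : (Z * M).trace = ((CFC.sqrt Z)ᵀ * (M * CFC.sqrt Z)).trace := by
      rw [hRs, ← hR, Matrix.mul_assoc, Matrix.trace_mul_comm, Matrix.mul_assoc, hR]
    rw [e, Matrix.trace]
    refine Finset.sum_congr rfl fun k _ => ?_
    rw [Matrix.diag_apply, Matrix.mul_apply_eq_vecMul]
    simp only [Matrix.vecMul, dotProduct, Matrix.mulVec, Matrix.mul_apply, Matrix.transpose_apply,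
      Matrix.col_apply]
  rw [key, key]
  exact Finset.sum_le_sum fun k _ => h _

end PosSemidef

/-! ### Gaussian integrals of exponentials of quadratic functions -/

section GaussianIntegral

theorem integrable_exp_quadratic_gaussianReal {l : ℝ} (hl : l < 1) (p : ℝ) :
    Integrable (fun x => Real.exp (p * x + l * x ^ 2 / 2)) (gaussianReal 0 1) ∧
    ∫ x, Real.exp (p * x + l * x ^ 2 / 2) ∂(gaussianReal 0 1)
      = (√(1 - l))⁻¹ * Real.exp (p ^ 2 / (2 * (1 - l))) := by
  have ha : 0 < 1 - l := by linarith
  -- Completing the square around p / (1 - l).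
  have e : ∀ x : ℝ, gaussianPDFReal 0 1 x * Real.exp (p * x + l * x ^ 2 / 2)
      = (√(2 * Real.pi))⁻¹ * Real.exp (p ^ 2 / (2 * (1 - l))) *
        Real.exp (-((1 - l) / 2) * (x - p / (1 - l)) ^ 2) := by
    intro x
    rw [gaussianPDFReal, mul_assoc (√_)⁻¹, mul_assoc (√_)⁻¹, ← Real.exp_add, ← Real.exp_add]
    congr 2
    · simp
    · simp
      field_simp
      ring
  constructor
  · rw [gaussianReal_of_var_ne_zero _ one_ne_zero, gaussianPDF_def,
      integrable_withDensity_iff_integrable_smul₀' (by fun_prop) (by simp)]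
    simp only [smul_eq_mul, ENNReal.toReal_ofReal (gaussianPDFReal_nonneg _ _ _)]
    simp_rw [e]
    exact ((integrable_exp_neg_mul_sq (by linarith : 0 < (1 - l) / 2)).comp_sub_right
      (p / (1 - l))).const_mul _
  · rw [integral_gaussianReal_eq_integral_smul one_ne_zero]
    simp only [smul_eq_mul]
    simp_rw [e]
    rw [integral_const_mul, integral_sub_right_eq_self (fun x => Real.exp (-((1 - l) / 2) * x ^ 2)),
      integral_gaussian]
    have : √(Real.pi / ((1 - l) / 2)) = √(2 * Real.pi) * (√(1 - l))⁻¹ := by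
      rw [← Real.sqrt_inv, ← Real.sqrt_mul (by positivity)]
      congr 1
      field_simp
    rw [this]
    have : √(2 * Real.pi) ≠ 0 := by positivity
    field_simp

variable {n : Type*} [Fintype n] [DecidableEq n]

/-- The standard Gaussian is a product measure in any orthonormal basis; in an eigenbasis of K the
integrand factors too, leaving one-dimensional integrals. -/
theorem integrable_exp_quadratic_stdGaussian {K : Matrix n n ℝ} (hK : K.IsSymm)
    (hK1 : (1 - K).PosDef) (p : n → ℝ) :
    Integrable (fun x : EuclideanSpace ℝ n =>
      Real.exp (p ⬝ᵥ x.ofLp + (1 / 2) * (x.ofLp ⬝ᵥ K *ᵥ x.ofLp))) (stdGaussian _) ∧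
    ∫ x : EuclideanSpace ℝ n, Real.exp (p ⬝ᵥ x.ofLp + (1 / 2) * (x.ofLp ⬝ᵥ K *ᵥ x.ofLp))
        ∂(stdGaussian _)
      = (√(1 - K).det)⁻¹ * Real.exp ((1 / 2) * (p ⬝ᵥ (1 - K)⁻¹ *ᵥ p)) := by
  have hH : K.IsHermitian := by
    rwa [Matrix.IsHermitian, Matrix.conjTranspose_eq_transpose_of_trivial]
  set b := hH.eigenvectorBasis with hb
  set l := hH.eigenvalues with hl
  -- the coordinates in the eigenbasis
  have hKb : ∀ i, K *ᵥ (b i).ofLp = l i • (b i).ofLp := fun i => hH.mulVec_eigenvectorBasis i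
  have hbb : ∀ i j, (b i).ofLp ⬝ᵥ (b j).ofLp = if i = j then 1 else 0 := by
    intro i j
    have := orthonormal_iff_ite.1 b.orthonormal j i
    rw [EuclideanSpace.inner_eq_star_dotProduct] at this
    simpa [eq_comm] using this
  have hM : ∀ i, (1 - K) *ᵥ (b i).ofLp = (1 - l i) • (b i).ofLp := by
    intro i
    rw [sub_mulVec, one_mulVec, hKb, sub_smul, one_smul]
  have hl1 : ∀ i, 0 < 1 - l i := by
    intro i
    have h0 : (b i).ofLp ≠ 0 := by
      intro h
      have := hbb i i
      simp [h] at this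
    have := hK1.dotProduct_mulVec_pos h0
    rw [hM, dotProduct_smul] at this
    simpa [hbb] using this
  have hdet1 : IsUnit (1 - K).det := (Matrix.isUnit_iff_isUnit_det _).1 hK1.isUnit
  have hMi : ∀ i, (1 - K)⁻¹ *ᵥ (b i).ofLp = (1 - l i)⁻¹ • (b i).ofLp := by
    intro i
    have h1 : (b i).ofLp = (1 - l i)⁻¹ • ((1 - K) *ᵥ (b i).ofLp) := by
      rw [hM, smul_smul, inv_mul_cancel₀ (hl1 i).ne', one_smul]
    conv_lhs => rw [h1]
    rw [mulVec_smul, mulVec_mulVec, Matrix.nonsing_inv_mul _ hdet1, one_mulVec]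
  have hdet : (1 - K).det = ∏ i, (1 - l i) := by
    have hs := hH.spectral_theorem
    rw [Unitary.conjStarAlgAut_apply] at hs
    set V := (hH.eigenvectorUnitary : Matrix n n ℝ)
    have hV : V * star V = 1 := Unitary.coe_mul_star_self _
    have : 1 - K = V * Matrix.diagonal (fun i => 1 - l i) * star V := by
      have e : Matrix.diagonal (fun i => 1 - l i) = 1 - Matrix.diagonal (RCLike.ofReal ∘ l) := by
        rw [← Matrix.diagonal_one, Matrix.diagonal_sub]
        rfl
      rw [e, mul_sub, sub_mul, mul_one, hV, ← hs]
    rw [this, Matrix.det_mul, Matrix.det_mul, mul_right_comm, ← Matrix.det_mul, hV,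
      Matrix.det_one, one_mul, Matrix.det_diagonal]
  set q : n → ℝ := fun i => p ⬝ᵥ (b i).ofLp with hq
  have hp : p = ∑ i, q i • (b i).ofLp := by
    have := b.sum_repr' (WithLp.toLp 2 p)
    have := congrArg WithLp.ofLp this
    rw [WithLp.ofLp_sum] at this
    simp only [EuclideanSpace.inner_eq_star_dotProduct, WithLp.ofLp_smul, star_trivial] at this
    exact this.symm
  have quad : ∀ (N : Matrix n n ℝ) (r : n → ℝ) (_ : ∀ i, N *ᵥ (b i).ofLp = r i • (b i).ofLp)
      (x : n → ℝ), (∑ i, x i • (b i).ofLp) ⬝ᵥ N *ᵥ (∑ i, x i • (b i).ofLp)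
        = ∑ i, r i * x i ^ 2 := by
    intro N r hN x
    simp only [mulVec_sum, mulVec_smul, hN, sum_dotProduct, dotProduct_sum, smul_dotProduct,
      dotProduct_smul, hbb, smul_eq_mul]
    refine Finset.sum_congr rfl fun i _ => ?_
    simp
    ring
  have hpq : p ⬝ᵥ (1 - K)⁻¹ *ᵥ p = ∑ i, (1 - l i)⁻¹ * q i ^ 2 := by
    conv_lhs => rw [hp]
    exact quad _ _ hMi q
  have hmeas : Measurable (fun x : n → ℝ => ∑ i, x i • b i) := by fun_prop
  have hcont : Continuous (fun x : EuclideanSpace ℝ n =>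
      Real.exp (p ⬝ᵥ x.ofLp + (1 / 2) * (x.ofLp ⬝ᵥ K *ᵥ x.ofLp))) := by
    simp only [dotProduct, mulVec]
    fun_prop
  have hf : ∀ x : n → ℝ, Real.exp (p ⬝ᵥ (∑ i, x i • b i).ofLp + (1 / 2) *
      ((∑ i, x i • b i).ofLp ⬝ᵥ K *ᵥ (∑ i, x i • b i).ofLp))
      = ∏ i, Real.exp (q i * x i + l i * x i ^ 2 / 2) := by
    intro x
    rw [WithLp.ofLp_sum]
    simp only [WithLp.ofLp_smul]
    rw [quad K l hKb, ← Real.exp_sum, Finset.sum_add_distrib]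
    congr 2
    · simp [dotProduct_sum, hq, mul_comm]
    · rw [Finset.mul_sum]
      exact Finset.sum_congr rfl fun i _ => by ring
  rw [stdGaussian_eq_map_pi_orthonormalBasis b]
  constructor
  · rw [integrable_map_measure hcont.aestronglyMeasurable hmeas.aemeasurable]
    simp only [Function.comp_def, hf]
    exact Integrable.fintype_prod (f := fun i t => Real.exp (q i * t + l i * t ^ 2 / 2))
      fun i => (integrable_exp_quadratic_gaussianReal (by linarith [hl1 i]) (q i)).1
  · rw [integral_map hmeas.aemeasurable hcont.aestronglyMeasurable]
    simp only [hf]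
    rw [integral_fintype_prod_eq_prod (f := fun i t => Real.exp (q i * t + l i * t ^ 2 / 2))]
    rw [hdet, hpq, Finset.mul_sum, Real.exp_sum, Real.sqrt_prod _ (fun i _ => (hl1 i).le),
      ← Finset.prod_inv_distrib, ← Finset.prod_mul_distrib]
    refine Finset.prod_congr rfl fun i _ => ?_
    rw [(integrable_exp_quadratic_gaussianReal (by linarith [hl1 i]) (q i)).2]
    congr 2
    have := (hl1 i).ne'
    field_simp

end GaussianIntegral

/-! ### Gaussian laws with general mean and covariance; Jensen and Hölder inequalities -/

section MultivariateGaussian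

theorem continuous_exp_quadratic {n : Type*} [Fintype n] (h : n → ℝ) (H : Matrix n n ℝ) :
    Continuous (fun ζ : EuclideanSpace ℝ n =>
      Real.exp (h ⬝ᵥ ζ.ofLp + (1 / 2) * (ζ.ofLp ⬝ᵥ H *ᵥ ζ.ofLp))) := by
  simp only [dotProduct, mulVec]
  fun_prop

variable {n : Type*} [Fintype n] [DecidableEq n]

theorem Matrix.isSymm_sqrt (Θ : Matrix n n ℝ) : (CFC.sqrt Θ).IsSymm := by
  have := (CFC.sqrt_nonneg Θ).posSemidef.1
  rwa [Matrix.IsHermitian, Matrix.conjTranspose_eq_transpose_of_trivial] at this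

theorem Matrix.PosDef.sqrt_mul_inv_mul_sqrt {Θ : Matrix n n ℝ} (hΘ : Θ.PosDef) :
    CFC.sqrt Θ * Θ⁻¹ * CFC.sqrt Θ = 1 ∧ IsUnit (CFC.sqrt Θ).det := by
  have hS : CFC.sqrt Θ * CFC.sqrt Θ = Θ := CFC.sqrt_mul_sqrt_self _ hΘ.posSemidef.nonneg
  have hdet : IsUnit (CFC.sqrt Θ).det := by
    have := (Matrix.isUnit_iff_isUnit_det Θ).1 hΘ.isUnit
    rw [← hS, Matrix.det_mul] at this
    exact isUnit_of_mul_isUnit_left this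
  refine ⟨?_, hdet⟩
  nth_rw 2 [← hS]
  rw [Matrix.mul_inv_rev, ← Matrix.mul_assoc, Matrix.mul_nonsing_inv _ hdet, Matrix.one_mul,
    Matrix.nonsing_inv_mul _ hdet]

theorem Matrix.PosDef.one_sub_sqrt_mul_mul_sqrt {Θ H : Matrix n n ℝ} (hΘ : Θ.PosDef) :
    1 - CFC.sqrt Θ * H * CFC.sqrt Θ = CFC.sqrt Θ * (Θ⁻¹ - H) * CFC.sqrt Θ := by
  rw [Matrix.mul_sub, Matrix.sub_mul, hΘ.sqrt_mul_inv_mul_sqrt.1]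

theorem Matrix.PosDef.posDef_one_sub_sqrt_mul_mul_sqrt {Θ H : Matrix n n ℝ} (hΘ : Θ.PosDef)
    (hK : (Θ⁻¹ - H).PosDef) : (1 - CFC.sqrt Θ * H * CFC.sqrt Θ).PosDef := by
  rw [hΘ.one_sub_sqrt_mul_mul_sqrt]
  have h := hK.conjTranspose_mul_mul_same (B := CFC.sqrt Θ)
    (Matrix.mulVec_injective_of_isUnit
      ((Matrix.isUnit_iff_isUnit_det _).2 hΘ.sqrt_mul_inv_mul_sqrt.2))
  rwa [Matrix.conjTranspose_eq_transpose_of_trivial, (Matrix.isSymm_sqrt Θ).eq] at h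

/-- Substituting ζ = μ + Sx with S = √Θ and x standard turns H into SHS and the linear coefficient
into S(h + Hμ). Since 1 - SHS = S(Θ⁻¹ - H)S, the factors S cancel in the exponent. -/
theorem integrable_exp_quadratic_multivariateGaussian {Θ H : Matrix n n ℝ} (hΘ : Θ.PosDef)
    (hH : H.IsSymm) (hK : (Θ⁻¹ - H).PosDef) (μ : EuclideanSpace ℝ n) (h : n → ℝ) :
    Integrable (fun ζ : EuclideanSpace ℝ n =>
      Real.exp (h ⬝ᵥ ζ.ofLp + (1 / 2) * (ζ.ofLp ⬝ᵥ H *ᵥ ζ.ofLp))) (multivariateGaussian μ Θ) ∧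
    ∫ ζ : EuclideanSpace ℝ n, Real.exp (h ⬝ᵥ ζ.ofLp + (1 / 2) * (ζ.ofLp ⬝ᵥ H *ᵥ ζ.ofLp))
        ∂(multivariateGaussian μ Θ)
      = (√(1 - CFC.sqrt Θ * H * CFC.sqrt Θ).det)⁻¹ *
        Real.exp (h ⬝ᵥ μ.ofLp + (1 / 2) * (μ.ofLp ⬝ᵥ H *ᵥ μ.ofLp) +
          (1 / 2) * ((h + H *ᵥ μ.ofLp) ⬝ᵥ (Θ⁻¹ - H)⁻¹ *ᵥ (h + H *ᵥ μ.ofLp))) := by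
  obtain ⟨-, hSdet⟩ := hΘ.sqrt_mul_inv_mul_sqrt
  have hSs : (CFC.sqrt Θ)ᵀ = CFC.sqrt Θ := (Matrix.isSymm_sqrt Θ).eq
  have hM := hΘ.posDef_one_sub_sqrt_mul_mul_sqrt hK
  have hMe := hΘ.one_sub_sqrt_mul_mul_sqrt (H := H)
  have hKs : (CFC.sqrt Θ * H * CFC.sqrt Θ).IsSymm := by
    rw [Matrix.IsSymm, Matrix.transpose_mul, Matrix.transpose_mul, hSs, hH.eq, Matrix.mul_assoc]
  set S := CFC.sqrt Θ with hS
  set v := h + H *ᵥ μ.ofLp with hv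
  have hG := integrable_exp_quadratic_stdGaussian hKs hM (S *ᵥ v)
  have hSdot : ∀ a c : n → ℝ, a ⬝ᵥ S *ᵥ c = (S *ᵥ a) ⬝ᵥ c := by
    intro a c
    rw [Matrix.dotProduct_mulVec_symm hSs, dotProduct_comm]
  have hinv : (S *ᵥ v) ⬝ᵥ (1 - S * H * S)⁻¹ *ᵥ (S *ᵥ v) = v ⬝ᵥ (Θ⁻¹ - H)⁻¹ *ᵥ v := by
    rw [hMe, Matrix.mul_inv_rev, Matrix.mul_inv_rev, ← hSdot, mulVec_mulVec, mulVec_mulVec]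
    congr 2
    simp only [Matrix.mul_assoc]
    rw [Matrix.nonsing_inv_mul _ hSdet, Matrix.mul_one, ← Matrix.mul_assoc,
      Matrix.mul_nonsing_inv _ hSdet, Matrix.one_mul]
  rw [hinv] at hG
  set c := h ⬝ᵥ μ.ofLp + (1 / 2) * (μ.ofLp ⬝ᵥ H *ᵥ μ.ofLp) with hc
  have hmeas : Measurable (fun x : EuclideanSpace ℝ n => μ + toEuclideanCLM (𝕜 := ℝ) S x) := by
    fun_prop
  have hf : ∀ x : EuclideanSpace ℝ n,
      Real.exp (h ⬝ᵥ (μ + toEuclideanCLM (𝕜 := ℝ) S x).ofLp + (1 / 2) *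
        ((μ + toEuclideanCLM (𝕜 := ℝ) S x).ofLp ⬝ᵥ H *ᵥ (μ + toEuclideanCLM (𝕜 := ℝ) S x).ofLp))
      = Real.exp c * Real.exp ((S *ᵥ v) ⬝ᵥ x.ofLp + (1 / 2) *
        (x.ofLp ⬝ᵥ (S * H * S) *ᵥ x.ofLp)) := by
    intro x
    rw [← Real.exp_add]
    congr 1
    have e1 : (S *ᵥ v) ⬝ᵥ x.ofLp = h ⬝ᵥ S *ᵥ x.ofLp + μ.ofLp ⬝ᵥ H *ᵥ (S *ᵥ x.ofLp) := by
      rw [← hSdot, hv, add_dotProduct, dotProduct_comm (H *ᵥ _),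
        Matrix.dotProduct_mulVec_symm hH]
    have e2 : x.ofLp ⬝ᵥ (S * H * S) *ᵥ x.ofLp = (S *ᵥ x.ofLp) ⬝ᵥ H *ᵥ (S *ᵥ x.ofLp) := by
      rw [← hSdot, mulVec_mulVec, mulVec_mulVec, Matrix.mul_assoc]
    rw [e1, e2, WithLp.ofLp_add, Matrix.ofLp_toEuclideanCLM, hc]
    simp only [mulVec_add, dotProduct_add, add_dotProduct]
    rw [Matrix.dotProduct_mulVec_symm hH (S *ᵥ x.ofLp) μ.ofLp]
    ring
  have hcont := continuous_exp_quadratic h H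
  rw [multivariateGaussian]
  constructor
  · rw [integrable_map_measure hcont.aestronglyMeasurable hmeas.aemeasurable]
    simp only [Function.comp_def, hf]
    exact hG.1.const_mul _
  · rw [integral_map hmeas.aemeasurable hcont.aestronglyMeasurable]
    simp only [hf]
    rw [integral_const_mul, hG.2, mul_left_comm, ← Real.exp_add]

theorem multivariateGaussian_conv {Θ D : Matrix n n ℝ} (hΘ : Θ.PosSemidef) (hD : D.PosSemidef)
    (μ : EuclideanSpace ℝ n) :
    multivariateGaussian μ Θ ∗ multivariateGaussian 0 D = multivariateGaussian μ (Θ + D) := by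
  apply Measure.ext_of_charFun
  ext t
  rw [charFun_conv, charFun_multivariateGaussian hΘ, charFun_multivariateGaussian hD,
    charFun_multivariateGaussian (hΘ.add hD), ← Complex.exp_add]
  congr 1
  rw [add_mulVec, dotProduct_add]
  simp
  ring

theorem integral_quadratic_multivariateGaussian {D : Matrix n n ℝ} (hD : D.PosSemidef)
    (p : n → ℝ) (H : Matrix n n ℝ) :
    Integrable (fun ξ : EuclideanSpace ℝ n => p ⬝ᵥ ξ.ofLp + (1 / 2) * (ξ.ofLp ⬝ᵥ H *ᵥ ξ.ofLp))
      (multivariateGaussian 0 D) ∧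
    ∫ ξ : EuclideanSpace ℝ n, p ⬝ᵥ ξ.ofLp + (1 / 2) * (ξ.ofLp ⬝ᵥ H *ᵥ ξ.ofLp)
      ∂(multivariateGaussian 0 D) = (1 / 2) * (D * H).trace := by
  set P := multivariateGaussian (0 : EuclideanSpace ℝ n) D with hP
  have hc : ∀ i, MemLp (fun ξ : EuclideanSpace ℝ n => ξ i) 2 P := fun i =>
    (IsGaussian.memLp_two_id (μ := P)).continuousLinearMap_comp (EuclideanSpace.proj (𝕜 := ℝ) i)
  have h1 : ∀ i, Integrable (fun ξ : EuclideanSpace ℝ n => ξ i) P := fun i =>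
    (hc i).integrable (by norm_num)
  have h0 : ∀ i, ∫ ξ : EuclideanSpace ℝ n, ξ i ∂P = 0 := by
    intro i
    have := ContinuousLinearMap.integral_comp_id_comm (μ := P) IsGaussian.integrable_id
      (EuclideanSpace.proj (𝕜 := ℝ) i)
    simpa [hP] using this
  have h2 : ∀ i j, Integrable (fun ξ : EuclideanSpace ℝ n => ξ i * ξ j) P := fun i j =>
    (hc i).integrable_mul (hc j)
  have h3 : ∀ i j, ∫ ξ : EuclideanSpace ℝ n, ξ i * ξ j ∂P = D i j := by
    intro i j
    rw [← covariance_eval_multivariateGaussian (μ := 0) hD i j,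
      covariance_eq_sub (hc i) (hc j), h0, h0]
    simp [hP]
  have e : ∀ ξ : EuclideanSpace ℝ n, p ⬝ᵥ ξ.ofLp + (1 / 2) * (ξ.ofLp ⬝ᵥ H *ᵥ ξ.ofLp)
      = ∑ i, p i * ξ i + (1 / 2) * ∑ i, ∑ j, H i j * (ξ i * ξ j) := by
    intro ξ
    simp only [dotProduct, mulVec, Finset.mul_sum]
    congr 1
    exact Finset.sum_congr rfl fun i _ => Finset.sum_congr rfl fun j _ => by ring
  simp only [e]
  have i1 : Integrable (fun ξ : EuclideanSpace ℝ n => ∑ i, p i * ξ i) P :=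
    integrable_finsetSum _ fun i _ => (h1 i).const_mul _
  have i3 : ∀ i, Integrable (fun ξ : EuclideanSpace ℝ n => ∑ j, H i j * (ξ i * ξ j)) P :=
    fun i => integrable_finsetSum _ fun j _ => (h2 i j).const_mul _
  have i2 : Integrable (fun ξ : EuclideanSpace ℝ n => ∑ i, ∑ j, H i j * (ξ i * ξ j)) P :=
    integrable_finsetSum _ fun i _ => i3 i
  refine ⟨i1.add (i2.const_mul _), ?_⟩
  rw [integral_add i1 (i2.const_mul _), integral_const_mul,
    integral_finsetSum _ (fun i _ => (h1 i).const_mul _),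
    integral_finsetSum _ (fun i _ => i3 i)]
  have : ∀ i, ∫ ξ : EuclideanSpace ℝ n, ∑ j, H i j * (ξ i * ξ j) ∂P = ∑ j, H i j * D i j := by
    intro i
    rw [integral_finsetSum _ fun j _ => (h2 i j).const_mul _]
    simp only [integral_const_mul, h3]
  simp only [this, integral_const_mul, h0, mul_zero, Finset.sum_const_zero, zero_add]
  rw [Matrix.trace_mul_comm, Matrix.trace]
  simp only [Matrix.diag_apply, Matrix.mul_apply]
  have hDs : ∀ i j, D j i = D i j := fun i j => by
    have := congrFun (congrFun hD.1 i) j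
    simpa using this
  simp only [hDs]

/-- Jensen's inequality for the exponential, without assuming the exponential integrable. -/
theorem ofReal_exp_integral_le_lintegral {Ω : Type*} [MeasurableSpace Ω] {P : Measure Ω}
    [IsProbabilityMeasure P] {f : Ω → ℝ} (hf : Integrable f P) :
    ENNReal.ofReal (Real.exp (∫ ω, f ω ∂P)) ≤ ∫⁻ ω, ENNReal.ofReal (Real.exp (f ω)) ∂P := by
  by_cases h : Integrable (fun ω => Real.exp (f ω)) P
  · rw [← ofReal_integral_eq_lintegral_ofReal h (ae_of_all _ fun _ => (Real.exp_pos _).le)]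
    exact ENNReal.ofReal_le_ofReal (convexOn_exp.map_integral_le Real.continuous_exp.continuousOn
      isClosed_univ (by simp) hf h)
  -- If the exponential is not integrable, the right-hand side is infinite.
  · have hm : AEStronglyMeasurable (fun ω => Real.exp (f ω)) P :=
      Real.continuous_exp.comp_aestronglyMeasurable hf.1
    have htop : ∫⁻ ω, ENNReal.ofReal (Real.exp (f ω)) ∂P = ⊤ := by
      by_contra hne
      exact h ⟨hm, (hasFiniteIntegral_iff_ofReal (ae_of_all _ fun _ => (Real.exp_pos _).le)).2
        (lt_top_iff_ne_top.2 hne)⟩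
    rw [htop]
    exact le_top

/-- Enlarging the covariance matrix by `D` multiplies the exponential moment of a quadratic form
with matrix `H / 2` by at least `exp (Tr (D H) / 2)`. -/
theorem lintegral_exp_quadratic_multivariateGaussian_le {Θ D H : Matrix n n ℝ} (hΘ : Θ.PosSemidef)
    (hD : D.PosSemidef) (hH : H.IsSymm) (μ : EuclideanSpace ℝ n) (h : n → ℝ) :
    (∫⁻ ζ : EuclideanSpace ℝ n, ENNReal.ofReal
        (Real.exp (h ⬝ᵥ ζ.ofLp + (1 / 2) * (ζ.ofLp ⬝ᵥ H *ᵥ ζ.ofLp))) ∂(multivariateGaussian μ Θ))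
        * ENNReal.ofReal (Real.exp ((1 / 2) * (D * H).trace))
      ≤ ∫⁻ ζ : EuclideanSpace ℝ n, ENNReal.ofReal
        (Real.exp (h ⬝ᵥ ζ.ofLp + (1 / 2) * (ζ.ofLp ⬝ᵥ H *ᵥ ζ.ofLp)))
        ∂(multivariateGaussian μ (Θ + D)) := by
  have hm : Measurable fun ζ : EuclideanSpace ℝ n => ENNReal.ofReal
      (Real.exp (h ⬝ᵥ ζ.ofLp + (1 / 2) * (ζ.ofLp ⬝ᵥ H *ᵥ ζ.ofLp))) :=
    (continuous_exp_quadratic h H).measurable.ennreal_ofReal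
  rw [← multivariateGaussian_conv hΘ hD, Measure.lintegral_conv hm, ← lintegral_mul_const _ hm]
  refine lintegral_mono fun ζ => ?_
  -- For fixed ζ the increment q(ζ + ξ) - q(ζ) is quadratic in ξ with linear coefficient h + Hζ, and
  -- its mean does not depend on ζ.
  obtain ⟨i1, i2⟩ := integral_quadratic_multivariateGaussian hD (h + H *ᵥ ζ.ofLp) H
  have := ofReal_exp_integral_le_lintegral i1
  rw [i2] at this
  refine (mul_le_mul_right this _).trans ?_
  rw [← lintegral_const_mul' _ _ ENNReal.ofReal_ne_top]
  refine lintegral_mono fun ξ => ?_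
  dsimp only
  rw [← ENNReal.ofReal_mul (Real.exp_pos _).le, ← Real.exp_add]
  refine ENNReal.ofReal_le_ofReal (Real.exp_le_exp.2 (le_of_eq ?_))
  rw [WithLp.ofLp_add]
  simp only [mulVec_add, dotProduct_add, add_dotProduct]
  rw [Matrix.dotProduct_mulVec_symm hH ξ.ofLp ζ.ofLp, dotProduct_comm (H *ᵥ ζ.ofLp),
    Matrix.dotProduct_mulVec_symm hH ξ.ofLp ζ.ofLp]
  ring

/-- The logarithm of the exponential integral is a convex function. -/
theorem log_integral_exp_convex {Ω : Type*} [MeasurableSpace Ω] {P : Measure Ω} [NeZero P]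
    {f g : Ω → ℝ} {a b : ℝ} (ha : 0 ≤ a) (hb : 0 ≤ b) (hab : a + b = 1)
    (hf : Integrable (fun ω => Real.exp (f ω)) P) (hg : Integrable (fun ω => Real.exp (g ω)) P)
    (hfg : Integrable (fun ω => Real.exp (a * f ω + b * g ω)) P) :
    Real.log (∫ ω, Real.exp (a * f ω + b * g ω) ∂P)
      ≤ a * Real.log (∫ ω, Real.exp (f ω) ∂P) + b * Real.log (∫ ω, Real.exp (g ω) ∂P) := by
  have hF := integral_exp_pos hf
  have hG := integral_exp_pos hg
  set F := ∫ ω, Real.exp (f ω) ∂P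
  set G := ∫ ω, Real.exp (g ω) ∂P
  rw [Real.log_le_iff_le_exp (integral_exp_pos hfg)]
  set t := a * Real.log F + b * Real.log G with ht
  have key : ∀ ω, Real.exp (a * f ω + b * g ω) ≤
      Real.exp t * (a * (Real.exp (f ω) / F) + b * (Real.exp (g ω) / G)) := by
    intro ω
    -- Hölder by normalization: subtracting ln F and ln G makes both exponentials integrate to 1, so
    -- the pointwise convexity bound integrates to a + b = 1.
    have := convexOn_exp.2 (Set.mem_univ (f ω - Real.log F)) (Set.mem_univ (g ω - Real.log G))
      ha hb hab
    rw [Real.exp_sub, Real.exp_sub, Real.exp_log hF, Real.exp_log hG] at this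
    simp only [smul_eq_mul] at this
    refine le_trans (le_of_eq ?_) (mul_le_mul_of_nonneg_left this (Real.exp_pos t).le)
    rw [← Real.exp_add]
    congr 1
    ring
  refine (integral_mono hfg ((((hf.div_const F).const_mul a).add
    ((hg.div_const G).const_mul b)).const_mul (Real.exp t)) key).trans (le_of_eq ?_)
  simp only [Pi.add_apply]
  rw [integral_const_mul, integral_add ((hf.div_const F).const_mul a)
    ((hg.div_const G).const_mul b), integral_const_mul, integral_const_mul, integral_div,
    integral_div, div_self hF.ne', div_self hG.ne', mul_one, mul_one, hab, mul_one]

end MultivariateGaussian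

namespace GaussLift

variable {d m : ℕ}

/-! ### The set `ℋ_γ` -/

theorem symm_inv {Θs : Matrix (Fin d) (Fin d) ℝ} (hΘs : Θs.PosDef) : Θs⁻¹.IsSymm := by
  have := hΘs.inv.1
  rwa [Matrix.IsHermitian, Matrix.conjTranspose_eq_transpose_of_trivial] at this

theorem mem_setH_iff {γ : ℝ} {Θs : Matrix (Fin d) (Fin d) ℝ} {x : Obs d} :
    x ∈ setH γ Θs ↔ (γ • Θs⁻¹ + x.2.1).PosSemidef ∧ (γ • Θs⁻¹ - x.2.1).PosSemidef := by
  rw [setH, Set.mem_ofPred_eq, sub_neg_eq_add, add_comm]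

/-- Θ⋆⁻¹ - H = (1 - γ)Θ⋆⁻¹ + (γΘ⋆⁻¹ - H). This makes the Gaussian integrals converge and keeps the
determinant positive on ℋ_γ. -/
theorem posDef_of_mem_setH {γ : ℝ} (hγ1 : γ < 1) {Θs : Matrix (Fin d) (Fin d) ℝ}
    (hΘs : Θs.PosDef) {x : Obs d} (hx : x ∈ setH γ Θs) : (Θs⁻¹ - x.2.1).PosDef := by
  have h := (hΘs.inv.smul (sub_pos.2 hγ1)).add_posSemidef (mem_setH_iff.1 hx).2
  rwa [sub_smul, one_smul, sub_add_sub_cancel] at h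

theorem nonempty_setH {γ : ℝ} (hγ0 : 0 < γ) {Θs : Matrix (Fin d) (Fin d) ℝ} (hΘs : Θs.PosDef) :
    (setH γ Θs).Nonempty :=
  ⟨0, mem_setH_iff.2 (by simpa using (hΘs.inv.smul hγ0).posSemidef)⟩

theorem neg_mem_setH {γ : ℝ} {Θs : Matrix (Fin d) (Fin d) ℝ} {x : Obs d} (hx : x ∈ setH γ Θs) :
    -x ∈ setH γ Θs := by
  rw [mem_setH_iff] at hx ⊢
  simpa [← sub_eq_add_neg] using hx.symm

theorem convex_setH (γ : ℝ) (Θs : Matrix (Fin d) (Fin d) ℝ) : Convex ℝ (setH γ Θs) := by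
  intro x hx y hy a b ha hb hab
  rw [mem_setH_iff] at hx hy ⊢
  have e : γ • Θs⁻¹ = a • (γ • Θs⁻¹) + b • (γ • Θs⁻¹) := by rw [← add_smul, hab, one_smul]
  constructor
  · convert (hx.1.smul ha).add (hy.1.smul hb) using 1
    simp only [Prod.snd_add, Prod.smul_snd, Submodule.coe_add, Submodule.coe_smul]
    conv_lhs => rw [e]
    module
  · convert (hx.2.smul ha).add (hy.2.smul hb) using 1
    simp only [Prod.snd_add, Prod.smul_snd, Submodule.coe_add, Submodule.coe_smul]
    conv_lhs => rw [e]
    module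

theorem continuous_coe_snd : Continuous fun x : Obs d => (x.2.1 : Matrix (Fin d) (Fin d) ℝ) :=
  continuous_subtype_val.comp continuous_snd

theorem isClosed_setH (γ : ℝ) {Θs : Matrix (Fin d) (Fin d) ℝ} (hΘs : Θs.PosDef) :
    IsClosed (setH γ Θs) := by
  have hP := symm_inv hΘs
  have e : setH γ Θs = ⋂ w : Fin d → ℝ, {x | 0 ≤ w ⬝ᵥ (γ • Θs⁻¹ + x.2.1) *ᵥ w} ∩
      {x | 0 ≤ w ⬝ᵥ (γ • Θs⁻¹ - x.2.1) *ᵥ w} := by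
    ext x
    rw [mem_setH_iff]
    simp only [Set.mem_iInter, Set.mem_inter_iff, Set.mem_ofPred_eq]
    refine ⟨fun h w => ⟨h.1.real_dotProduct_nonneg w, h.2.real_dotProduct_nonneg w⟩, fun h =>
      ⟨.of_real_dotProduct_nonneg ((hP.smul γ).add x.2.2) fun w => (h w).1,
        .of_real_dotProduct_nonneg ((hP.smul γ).sub x.2.2) fun w => (h w).2⟩⟩
  have hc := continuous_coe_snd (d := d)
  rw [e]
  refine isClosed_iInter fun w => IsClosed.inter ?_ ?_
  · exact isClosed_le continuous_const
      (continuous_const.dotProduct ((continuous_const.add hc).matrix_mulVec continuous_const))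
  · exact isClosed_le continuous_const
      (continuous_const.dotProduct ((continuous_const.sub hc).matrix_mulVec continuous_const))

/-- On `ℋ_γ` the entries of the matrix component are bounded. -/
theorem exists_abs_le_of_mem_setH (γ : ℝ) {Θs : Matrix (Fin d) (Fin d) ℝ} (hΘs : Θs.PosDef) :
    ∃ C, 0 ≤ C ∧ ∀ x ∈ setH γ Θs, ∀ i j, |x.2.1 i j| ≤ C := by
  have hP := (symm_inv hΘs).smul γ
  refine ⟨∑ i, ∑ j, |(1 / 2) * ((γ • Θs⁻¹) i i + (γ • Θs⁻¹) j j)|, by positivity,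
    fun x hx i j => ?_⟩
  rw [mem_setH_iff] at hx
  have h := Matrix.PosSemidef.abs_dotProduct_mulVec_le x.2.2 hx.1 hx.2 hP
    (Pi.single i 1) (Pi.single j 1)
  simp only [Matrix.mulVec_single_one, single_one_dotProduct, Matrix.col_apply] at h
  refine h.trans ((le_abs_self _).trans ?_)
  refine le_trans ?_ (Finset.single_le_sum (f := fun i => ∑ j, |(1 / 2) * ((γ • Θs⁻¹) i i +
    (γ • Θs⁻¹) j j)|) (fun i _ => by positivity) (Finset.mem_univ i))
  exact Finset.single_le_sum (f := fun j => |(1 / 2) * ((γ • Θs⁻¹) i i + (γ • Θs⁻¹) j j)|)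
    (fun i _ => by positivity) (Finset.mem_univ j)

/-! ### The quadratic form of `matQ` -/

/-- When the last coordinate of w is 1, this is twice the exponent in the Gaussian integral with
mean Aw and covariance Θ⋆. -/
theorem dotProduct_matQ_mulVec (A : Matrix (Fin d) (Fin m ⊕ Unit) ℝ)
    (Θs : Matrix (Fin d) (Fin d) ℝ) (x : Obs d) (w : Fin m ⊕ Unit → ℝ) :
    w ⬝ᵥ matQ A Θs x *ᵥ w = 2 * w (Sum.inr ()) * (x.1.ofLp ⬝ᵥ A *ᵥ w) +
      (A *ᵥ w) ⬝ᵥ x.2.1 *ᵥ (A *ᵥ w) +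
      (w (Sum.inr ()) • x.1.ofLp + x.2.1 *ᵥ (A *ᵥ w)) ⬝ᵥ (Θs⁻¹ - x.2.1)⁻¹ *ᵥ
        (w (Sum.inr ()) • x.1.ofLp + x.2.1 *ᵥ (A *ᵥ w)) := by
  have hb : lastOrth m ⬝ᵥ w = w (Sum.inr ()) := by
    simp [lastOrth, dotProduct, Fintype.sum_sum_type]
  have hv : matHh x *ᵥ (matB A *ᵥ w) = w (Sum.inr ()) • x.1.ofLp + x.2.1 *ᵥ (A *ᵥ w) := by
    rw [matB, Matrix.fromRows_mulVec, matHh, Matrix.fromCols_mulVec]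
    simp only [Sum.elim_comp_inl, Sum.elim_comp_inr]
    rw [add_comm]
    congr 1
    ext i
    simp [mulVec, hb, dotProduct_comm]
  rw [matQ]
  simp only [add_mulVec, dotProduct_add, ← mulVec_mulVec, Matrix.dotProduct_mulVec w _ᵀ,
    Matrix.vecMul_transpose, hv]
  rw [Matrix.dotProduct_mulVec _ (matHh x)ᵀ, Matrix.vecMul_transpose, hv]
  simp only [vecMulVec_mulVec, dotProduct_smul, op_smul_eq_smul, smul_eq_mul, hb]
  rw [dotProduct_comm w, hb, dotProduct_comm _ x.1.ofLp]
  ring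

/-- For fixed w the first two terms of the form are linear in (h, H), and the third is the matrix
fractional function of a pair (v, K) affine in (h, H). -/
theorem dotProduct_matQ_mulVec_convex {γ : ℝ} (hγ1 : γ < 1) {Θs : Matrix (Fin d) (Fin d) ℝ}
    (hΘs : Θs.PosDef) (A : Matrix (Fin d) (Fin m ⊕ Unit) ℝ) {x y : Obs d} (hx : x ∈ setH γ Θs)
    (hy : y ∈ setH γ Θs) {a b : ℝ} (ha : 0 ≤ a) (hb : 0 ≤ b) (hab : a + b = 1)
    (w : Fin m ⊕ Unit → ℝ) :
    w ⬝ᵥ matQ A Θs (a • x + b • y) *ᵥ w ≤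
      w ⬝ᵥ (a • matQ A Θs x + b • matQ A Θs y) *ᵥ w := by
  have hK := posDef_of_mem_setH hγ1 hΘs hx
  have hL := posDef_of_mem_setH hγ1 hΘs hy
  have hKL := posDef_of_mem_setH hγ1 hΘs (convex_setH γ Θs hx hy ha hb hab)
  have e : Θs⁻¹ - (a • x + b • y).2.1 = a • (Θs⁻¹ - x.2.1) + b • (Θs⁻¹ - y.2.1) := by
    have e1 : Θs⁻¹ = a • Θs⁻¹ + b • Θs⁻¹ := by rw [← add_smul, hab, one_smul]
    conv_lhs => rw [e1]
    simp only [Prod.snd_add, Prod.smul_snd, Submodule.coe_add, Submodule.coe_smul]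
    module
  rw [add_mulVec, smul_mulVec, smul_mulVec, dotProduct_add, dotProduct_smul, dotProduct_smul,
    dotProduct_matQ_mulVec, dotProduct_matQ_mulVec, dotProduct_matQ_mulVec, e]
  rw [e] at hKL
  have h := hK.dotProduct_inv_mulVec_convex hL (w (Sum.inr ()) • x.1.ofLp + x.2.1 *ᵥ (A *ᵥ w))
    (w (Sum.inr ()) • y.1.ofLp + y.2.1 *ᵥ (A *ᵥ w)) ha hb hKL
  have ev : w (Sum.inr ()) • (a • x + b • y).1.ofLp + (a • x + b • y).2.1 *ᵥ (A *ᵥ w) =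
      a • (w (Sum.inr ()) • x.1.ofLp + x.2.1 *ᵥ (A *ᵥ w)) +
      b • (w (Sum.inr ()) • y.1.ofLp + y.2.1 *ᵥ (A *ᵥ w)) := by
    simp only [Prod.fst_add, Prod.smul_fst, WithLp.ofLp_add, WithLp.ofLp_smul, Prod.snd_add,
      Prod.smul_snd, Submodule.coe_add, Submodule.coe_smul, add_mulVec, smul_mulVec]
    module
  rw [ev]
  simp only [Prod.fst_add, Prod.smul_fst, WithLp.ofLp_add, WithLp.ofLp_smul, Prod.snd_add,
      Prod.smul_snd, Submodule.coe_add, Submodule.coe_smul, add_mulVec, smul_mulVec,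
      add_dotProduct, smul_dotProduct, dotProduct_add, dotProduct_smul, smul_eq_mul] at h ⊢
  linarith

/-! ### The support function and `Γ_𝒵` -/

section SupportFn

variable {n : Type*} [Fintype n] {𝒵 : Set (SymMat n)}

theorem continuous_trace_mul (W : Matrix n n ℝ) :
    Continuous fun Z : SymMat n => (Z.1 * W).trace :=
  (continuous_subtype_val.matrix_mul continuous_const).matrix_trace

theorem trace_mul_le_supportFn (h𝒵 : IsCompact 𝒵) {Z : SymMat n} (hZ : Z ∈ 𝒵)
    (W : Matrix n n ℝ) : (Z.1 * W).trace ≤ supportFn 𝒵 W :=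
  le_csSup (h𝒵.bddAbove_image (continuous_trace_mul W).continuousOn) (Set.mem_image_of_mem _ hZ)

theorem supportFn_le (hne : 𝒵.Nonempty) {W : Matrix n n ℝ} {c : ℝ}
    (h : ∀ Z ∈ 𝒵, (Z.1 * W).trace ≤ c) : supportFn 𝒵 W ≤ c :=
  csSup_le (hne.image _) (by rintro _ ⟨Z, hZ, rfl⟩; exact h Z hZ)

theorem continuous_supportFn (h𝒵 : IsCompact 𝒵) : Continuous (supportFn 𝒵) := by
  refine h𝒵.continuous_sSup (f := fun W (Z : SymMat n) => (Z.1 * W).trace) ?_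
  exact ((continuous_subtype_val.comp continuous_snd).matrix_mul continuous_fst).matrix_trace

theorem trace_outer_mul (w : n → ℝ) (W : Matrix n n ℝ) :
    ((outer w).1 * W).trace = w ⬝ᵥ W *ᵥ w := by
  rw [outer, Matrix.trace_mul_comm, Matrix.mul_vecMulVec, Matrix.trace_vecMulVec, dotProduct_comm]

end SupportFn

theorem convexOn_gammaZ {γ : ℝ} (hγ1 : γ < 1) {Θs : Matrix (Fin d) (Fin d) ℝ}
    (hΘs : Θs.PosDef) (A : Matrix (Fin d) (Fin m ⊕ Unit) ℝ) {𝒵 : Set (SymMat (Fin m ⊕ Unit))}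
    (h𝒵_compact : IsCompact 𝒵) (hne : 𝒵.Nonempty) (h𝒵_psd : ∀ W ∈ 𝒵, W.1.PosSemidef) :
    ConvexOn ℝ (setH γ Θs) (gammaZ A Θs 𝒵) := by
  refine ⟨convex_setH γ Θs, fun x hx y hy a b ha hb hab => ?_⟩
  have key : supportFn 𝒵 (matQ A Θs (a • x + b • y)) ≤
      a * supportFn 𝒵 (matQ A Θs x) + b * supportFn 𝒵 (matQ A Θs y) := by
    refine supportFn_le hne fun Z hZ => ?_
    refine (Matrix.trace_mul_le_of_forall_dotProduct_le (h𝒵_psd Z hZ)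
      (dotProduct_matQ_mulVec_convex hγ1 hΘs A hx hy ha hb hab)).trans ?_
    rw [Matrix.mul_add, Matrix.mul_smul, Matrix.mul_smul, Matrix.trace_add, Matrix.trace_smul,
      Matrix.trace_smul, smul_eq_mul, smul_eq_mul]
    gcongr <;> exact trace_mul_le_supportFn h𝒵_compact hZ _
  simp only [gammaZ, smul_eq_mul]
  linarith

/-- The inverse is the adjugate divided by a nonvanishing determinant. -/
theorem continuousOn_inv_of_posDef {X n : Type*} [TopologicalSpace X] [Fintype n] [DecidableEq n]
    {s : Set X} {f : X → Matrix n n ℝ} (hf : ContinuousOn f s) (h : ∀ x ∈ s, (f x).PosDef) :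
    ContinuousOn (fun x => (f x)⁻¹) s := by
  simp only [Matrix.inv_def, Ring.inverse_eq_inv']
  have hd : ContinuousOn (fun x => (f x).det) s :=
    (continuous_id.matrix_det).comp_continuousOn hf
  have ha : ContinuousOn (fun x => (f x).adjugate) s :=
    (continuous_id.matrix_adjugate).comp_continuousOn hf
  exact (hd.inv₀ fun x hx => (h x hx).det_pos.ne').smul ha

theorem continuousOn_gammaZ {γ : ℝ} (hγ1 : γ < 1) {Θs : Matrix (Fin d) (Fin d) ℝ}
    (hΘs : Θs.PosDef) (A : Matrix (Fin d) (Fin m ⊕ Unit) ℝ) {𝒵 : Set (SymMat (Fin m ⊕ Unit))}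
    (h𝒵_compact : IsCompact 𝒵) : ContinuousOn (gammaZ A Θs 𝒵) (setH γ Θs) := by
  have hc := continuous_coe_snd (d := d)
  have hh : Continuous fun x : Obs d => x.1.ofLp := by fun_prop
  have hinv : ContinuousOn (fun x : Obs d => (Θs⁻¹ - x.2.1)⁻¹) (setH γ Θs) :=
    continuousOn_inv_of_posDef (continuous_const.sub hc).continuousOn
      fun x hx => posDef_of_mem_setH hγ1 hΘs hx
  have hHh : Continuous fun x : Obs d => matHh x := by
    refine continuous_pi fun i => continuous_pi fun j => ?_
    rcases j with j | j
    · exact hc.matrix_elem i j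
    · exact (continuous_apply i).comp hh
  have hmul : ∀ {p q r : Type} [Fintype q] {f : Obs d → Matrix p q ℝ} {g : Obs d → Matrix q r ℝ},
      ContinuousOn f (setH γ Θs) → ContinuousOn g (setH γ Θs) →
      ContinuousOn (fun x => f x * g x) (setH γ Θs) := by
    intro p q r _ f g hf hg
    rw [continuousOn_iff_continuous_domRestrict] at hf hg ⊢
    exact hf.matrix_mul hg
  refine continuousOn_const.mul ((continuous_supportFn h𝒵_compact).comp_continuousOn ?_)
  unfold matQ
  refine ContinuousOn.add (Continuous.continuousOn ?_) ?_
  · exact (((continuous_const.matrix_vecMulVec hh).matrix_mul continuous_const).add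
      (continuous_const.matrix_mul (hh.matrix_vecMulVec continuous_const))).add
      ((continuous_const.matrix_mul hc).matrix_mul continuous_const)
  · exact hmul (hmul (hmul (continuous_const.matrix_mul hHh.matrix_transpose).continuousOn hinv)
      hHh.continuousOn) continuousOn_const

end GaussLift

/-! ### The Frobenius norm and entrywise bounds -/

section Entrywise

variable {n : Type*} [Fintype n]

theorem frobNorm_sq (M : Matrix n n ℝ) : frobNorm M ^ 2 = ∑ i, ∑ j, M i j ^ 2 :=
  Real.sq_sqrt (by positivity)

theorem frobNorm_sq_convex (M N : Matrix n n ℝ) {a b : ℝ} (ha : 0 ≤ a) (hb : 0 ≤ b)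
    (hab : a + b = 1) :
    frobNorm (a • M + b • N) ^ 2 ≤ a * frobNorm M ^ 2 + b * frobNorm N ^ 2 := by
  simp only [frobNorm_sq, Finset.mul_sum, ← Finset.sum_add_distrib]
  refine Finset.sum_le_sum fun i _ => Finset.sum_le_sum fun j _ => ?_
  exact (even_two.convexOn_pow (𝕜 := ℝ)).2 (Set.mem_univ _)
    (Set.mem_univ _) ha hb hab

theorem continuous_frobNorm : Continuous (frobNorm : Matrix n n ℝ → ℝ) := by
  unfold frobNorm
  refine Real.continuous_sqrt.comp (continuous_finsetSum _ fun i _ =>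
    continuous_finsetSum _ fun j _ => (continuous_id.matrix_elem i j).pow 2)

theorem Matrix.abs_dotProduct_mulVec_le {M : Matrix n n ℝ} {C : ℝ} (hM : ∀ i j, |M i j| ≤ C)
    (x y : n → ℝ) : |x ⬝ᵥ M *ᵥ y| ≤ C * (∑ i, |x i|) * ∑ j, |y j| := by
  rw [mul_assoc, Finset.sum_mul_sum, Finset.mul_sum]
  refine (Finset.abs_sum_le_sum_abs _ _).trans (Finset.sum_le_sum fun i _ => ?_)
  rw [abs_mul, mulVec, dotProduct, Finset.mul_sum]
  refine (mul_le_mul_of_nonneg_left (Finset.abs_sum_le_sum_abs _ _) (abs_nonneg _)).trans ?_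
  rw [Finset.mul_sum]
  refine Finset.sum_le_sum fun j _ => ?_
  rw [abs_mul]
  have := mul_le_mul_of_nonneg_right (hM i j) (mul_nonneg (abs_nonneg (x i)) (abs_nonneg (y j)))
  linarith

theorem Matrix.abs_trace_mul_le {M : Matrix n n ℝ} {C : ℝ} (hM : ∀ i j, |M i j| ≤ C)
    (N : Matrix n n ℝ) : |(N * M).trace| ≤ C * ∑ i, ∑ j, |N i j| := by
  rw [Matrix.trace, Finset.mul_sum]
  refine (Finset.abs_sum_le_sum_abs _ _).trans (Finset.sum_le_sum fun i _ => ?_)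
  rw [Matrix.diag_apply, Matrix.mul_apply, Finset.mul_sum]
  refine (Finset.abs_sum_le_sum_abs _ _).trans (Finset.sum_le_sum fun j _ => ?_)
  rw [abs_mul, mul_comm]
  exact mul_le_mul_of_nonneg_right (hM j i) (abs_nonneg _)

theorem EuclideanSpace.sum_abs_le (x : EuclideanSpace ℝ n) :
    ∑ i, |x i| ≤ Fintype.card n * ‖x‖ := by
  calc ∑ i, |x i| ≤ ∑ _i : n, ‖x‖ := Finset.sum_le_sum fun i _ => by
        simpa using PiLp.norm_apply_le x i
    _ = _ := by simp

end Entrywise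

namespace GaussLift

variable {d m : ℕ}

/-! ### Regularity of the data -/

theorem log_integral_exp_quadratic {Θs : Matrix (Fin d) (Fin d) ℝ} (hΘs : Θs.PosDef) {x : Obs d}
    (hK : (Θs⁻¹ - x.2.1).PosDef) (μ : EuclideanSpace ℝ (Fin d)) (h : Fin d → ℝ) :
    Real.log (∫ ζ : EuclideanSpace ℝ (Fin d),
        Real.exp (h ⬝ᵥ ζ.ofLp + (1 / 2) * (ζ.ofLp ⬝ᵥ x.2.1 *ᵥ ζ.ofLp))
        ∂(multivariateGaussian μ Θs))
      = -(1 / 2) * Real.log (1 - CFC.sqrt Θs * x.2.1 * CFC.sqrt Θs).det +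
        (h ⬝ᵥ μ.ofLp + (1 / 2) * (μ.ofLp ⬝ᵥ x.2.1 *ᵥ μ.ofLp) +
          (1 / 2) * ((h + x.2.1 *ᵥ μ.ofLp) ⬝ᵥ (Θs⁻¹ - x.2.1)⁻¹ *ᵥ (h + x.2.1 *ᵥ μ.ofLp))) := by
  have hdet := (hΘs.posDef_one_sub_sqrt_mul_mul_sqrt hK).det_pos
  rw [(integrable_exp_quadratic_multivariateGaussian hΘs x.2.2 hK μ h).2,
    Real.log_mul (inv_ne_zero (Real.sqrt_pos.2 hdet).ne') (Real.exp_pos _).ne', Real.log_inv,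
    Real.log_sqrt hdet.le, Real.log_exp]
  ring

theorem convexOn_neg_log_det {γ : ℝ} (hγ1 : γ < 1) {Θs : Matrix (Fin d) (Fin d) ℝ}
    (hΘs : Θs.PosDef) : ConvexOn ℝ (setH γ Θs) fun x : Obs d =>
      -(1 / 2) * Real.log (1 - CFC.sqrt Θs * x.2.1 * CFC.sqrt Θs).det := by
  refine ⟨convex_setH γ Θs, fun x hx y hy a b ha hb hab => ?_⟩
  -- With h = 0 and zero mean, the log-moment reduces to the determinant term, and the exponent is
  -- linear in H.
  have e : ∀ z ∈ setH γ Θs, -(1 / 2) * Real.log (1 - CFC.sqrt Θs * z.2.1 * CFC.sqrt Θs).det =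
      Real.log (∫ ζ : EuclideanSpace ℝ (Fin d),
        Real.exp (0 ⬝ᵥ ζ.ofLp + (1 / 2) * (ζ.ofLp ⬝ᵥ z.2.1 *ᵥ ζ.ofLp))
        ∂(multivariateGaussian 0 Θs)) := by
    intro z hz
    rw [log_integral_exp_quadratic hΘs (posDef_of_mem_setH hγ1 hΘs hz)]
    simp
  have hi : ∀ z ∈ setH γ Θs, _ := fun z hz =>
    (integrable_exp_quadratic_multivariateGaussian hΘs z.2.2 (posDef_of_mem_setH hγ1 hΘs hz)
      0 0).1
  have hxy := convex_setH γ Θs hx hy ha hb hab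
  have hlin : ∀ ζ : EuclideanSpace ℝ (Fin d),
      0 ⬝ᵥ ζ.ofLp + (1 / 2) * (ζ.ofLp ⬝ᵥ (a • x + b • y).2.1 *ᵥ ζ.ofLp) =
      a * (0 ⬝ᵥ ζ.ofLp + (1 / 2) * (ζ.ofLp ⬝ᵥ x.2.1 *ᵥ ζ.ofLp)) +
      b * (0 ⬝ᵥ ζ.ofLp + (1 / 2) * (ζ.ofLp ⬝ᵥ y.2.1 *ᵥ ζ.ofLp)) := by
    intro ζ
    simp only [Prod.snd_add, Prod.smul_snd, Submodule.coe_add, Submodule.coe_smul, add_mulVec,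
      smul_mulVec, dotProduct_add, dotProduct_smul, smul_eq_mul, zero_dotProduct]
    ring
  have h3 := hi _ hxy
  simp only [smul_eq_mul]
  rw [e _ hxy, e _ hx, e _ hy]
  simp only [hlin] at h3 ⊢
  exact log_integral_exp_convex ha hb hab (hi _ hx) (hi _ hy) h3

theorem convexOn_Phi {γ δ : ℝ} (hγ1 : γ < 1) (hδ0 : 0 ≤ δ) (hδ2 : δ ≤ 2)
    {Θs : Matrix (Fin d) (Fin d) ℝ} (hΘs : Θs.PosDef) (A : Matrix (Fin d) (Fin m ⊕ Unit) ℝ)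
    {𝒵 : Set (SymMat (Fin m ⊕ Unit))} (h𝒵_compact : IsCompact 𝒵) (hne : 𝒵.Nonempty)
    (h𝒵_psd : ∀ W ∈ 𝒵, W.1.PosSemidef) (Θ : SymMat (Fin d)) :
    ConvexOn ℝ (setH γ Θs) fun x => Phi A Θs 𝒵 γ δ x Θ := by
  have hc : 0 ≤ δ * (2 - δ) / (2 * (1 - γ)) :=
    div_nonneg (mul_nonneg hδ0 (by linarith)) (by linarith)
  refine ((convexOn_neg_log_det hγ1 hΘs).add ⟨convex_setH γ Θs, ?_⟩).add ⟨convex_setH γ Θs, ?_⟩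
    |>.add (convexOn_gammaZ hγ1 hΘs A h𝒵_compact hne h𝒵_psd)
  · intro x _ y _ a b _ _ _
    simp only [Prod.snd_add, Prod.smul_snd, Submodule.coe_add, Submodule.coe_smul, Matrix.mul_add,
      Matrix.mul_smul, Matrix.trace_add, Matrix.trace_smul, smul_eq_mul]
    exact le_of_eq (by ring)
  · intro x _ y _ a b ha hb hab
    simp only [Prod.snd_add, Prod.smul_snd, Submodule.coe_add, Submodule.coe_smul, Matrix.mul_add,
      Matrix.mul_smul, Matrix.add_mul, Matrix.smul_mul, smul_eq_mul]
    have := mul_le_mul_of_nonneg_left (frobNorm_sq_convex (CFC.sqrt Θs * x.2.1 * CFC.sqrt Θs)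
      (CFC.sqrt Θs * y.2.1 * CFC.sqrt Θs) ha hb hab) hc
    linarith

theorem concaveOn_Phi {γ δ : ℝ} {Θs : Matrix (Fin d) (Fin d) ℝ}
    (A : Matrix (Fin d) (Fin m ⊕ Unit) ℝ) {𝒵 : Set (SymMat (Fin m ⊕ Unit))}
    {𝒰 : Set (SymMat (Fin d))} (h𝒰 : Convex ℝ 𝒰) (x : Obs d) :
    ConcaveOn ℝ 𝒰 fun Θ => Phi A Θs 𝒵 γ δ x Θ := by
  refine ⟨h𝒰, fun Θ _ Θ' _ a b _ _ hab => le_of_eq ?_⟩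
  simp only [Phi, Submodule.coe_add, Submodule.coe_smul, Matrix.sub_mul, Matrix.add_mul,
    Matrix.smul_mul, Matrix.trace_add, Matrix.trace_sub, Matrix.trace_smul, smul_eq_mul]
  obtain rfl : b = 1 - a := by linarith
  ring

theorem continuousOn_Phi {γ δ : ℝ} (hγ1 : γ < 1) {Θs : Matrix (Fin d) (Fin d) ℝ}
    (hΘs : Θs.PosDef) (A : Matrix (Fin d) (Fin m ⊕ Unit) ℝ) {𝒵 : Set (SymMat (Fin m ⊕ Unit))}
    (h𝒵_compact : IsCompact 𝒵) (𝒰 : Set (SymMat (Fin d))) :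
    ContinuousOn (fun p : Obs d × SymMat (Fin d) => Phi A Θs 𝒵 γ δ p.1 p.2)
      (setH γ Θs ×ˢ 𝒰) := by
  have hc : Continuous fun p : Obs d × SymMat (Fin d) => p.1.2.1 :=
    continuous_coe_snd.comp continuous_fst
  have hS : Continuous fun p : Obs d × SymMat (Fin d) => CFC.sqrt Θs * p.1.2.1 * CFC.sqrt Θs :=
    (continuous_const.matrix_mul hc).matrix_mul continuous_const
  have hΘ : Continuous fun p : Obs d × SymMat (Fin d) => p.2.1 :=
    continuous_subtype_val.comp continuous_snd
  refine ((ContinuousOn.add ?_ ?_).add ?_).add ?_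
  · refine continuousOn_const.mul (ContinuousOn.log
      (continuous_const.sub hS).matrix_det.continuousOn fun p hp => ?_)
    exact (hΘs.posDef_one_sub_sqrt_mul_mul_sqrt
      (posDef_of_mem_setH hγ1 hΘs hp.1)).det_pos.ne'
  · exact (continuous_const.mul
      ((hΘ.sub continuous_const).matrix_mul hc).matrix_trace).continuousOn
  · exact (continuous_const.mul ((continuous_frobNorm.comp hS).pow 2)).continuousOn
  · exact (continuousOn_gammaZ hγ1 hΘs A h𝒵_compact).comp continuousOn_fst fun p hp => hp.1

/-! ### Exponential moments of the lifted Gaussian distributions -/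

theorem pairing_outer (x : Obs d) (ζ : EuclideanSpace ℝ (Fin d)) :
    pairing d x (ζ, outer ζ.ofLp) =
      x.1.ofLp ⬝ᵥ ζ.ofLp + (1 / 2) * (ζ.ofLp ⬝ᵥ x.2.1 *ᵥ ζ.ofLp) := by
  rw [← trace_outer_mul, Matrix.trace_mul_comm]
  rfl

theorem continuous_lift :
    Continuous fun ζ : EuclideanSpace ℝ (Fin d) => ((ζ, outer ζ.ofLp) : Obs d) := by
  refine continuous_id.prodMk (Continuous.subtype_mk ?_ _)
  have hh : Continuous fun x : EuclideanSpace ℝ (Fin d) => x.ofLp := by fun_prop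
  exact hh.matrix_vecMulVec hh

/-- The part of `Φ` lower bounding `Γ_𝒵` at the point `[u; 1][u; 1]ᵀ`. -/
theorem quadratic_le_gammaZ {Θs : Matrix (Fin d) (Fin d) ℝ} (A : Matrix (Fin d) (Fin m ⊕ Unit) ℝ)
    {𝒵 : Set (SymMat (Fin m ⊕ Unit))} (h𝒵_compact : IsCompact 𝒵)
    {u : EuclideanSpace ℝ (Fin m)} (hu : outer (aug u) ∈ 𝒵) (x : Obs d) :
    x.1.ofLp ⬝ᵥ A *ᵥ aug u + (1 / 2) * ((A *ᵥ aug u) ⬝ᵥ x.2.1 *ᵥ (A *ᵥ aug u)) +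
      (1 / 2) * ((x.1.ofLp + x.2.1 *ᵥ (A *ᵥ aug u)) ⬝ᵥ (Θs⁻¹ - x.2.1)⁻¹ *ᵥ
        (x.1.ofLp + x.2.1 *ᵥ (A *ᵥ aug u))) ≤ gammaZ A Θs 𝒵 x := by
  have h := trace_mul_le_supportFn h𝒵_compact hu (matQ A Θs x)
  rw [trace_outer_mul, dotProduct_matQ_mulVec] at h
  have e : aug u (Sum.inr ()) = 1 := rfl
  rw [e, one_smul] at h
  rw [gammaZ]
  linarith

/-- The parameter witnessing membership is Θ itself. Comparison with Θ⋆ avoids Θ⁻¹, so Θ may be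
singular. -/
theorem liftedLaw_mem_simpleFamily {γ δ : ℝ} (hγ1 : γ < 1) (hδ0 : 0 ≤ δ) (hδ2 : δ ≤ 2)
    {Θs : Matrix (Fin d) (Fin d) ℝ} (hΘs : Θs.PosDef) (A : Matrix (Fin d) (Fin m ⊕ Unit) ℝ)
    {𝒵 : Set (SymMat (Fin m ⊕ Unit))} (h𝒵_compact : IsCompact 𝒵)
    {u : EuclideanSpace ℝ (Fin m)} (hu : outer (aug u) ∈ 𝒵) {𝒰 : Set (SymMat (Fin d))}
    {Θ : SymMat (Fin d)} (hΘ : Θ ∈ 𝒰) (hΘ_psd : Θ.1.PosSemidef) (hΘ_le : (Θs - Θ.1).PosSemidef) :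
    liftedLaw A u Θ ∈ simpleFamily (pairing d) (setH γ Θs) 𝒰 (Phi A Θs 𝒵 γ δ) := by
  have hmeas := (continuous_lift (d := d)).measurable
  refine ⟨Measure.isProbabilityMeasure_map hmeas.aemeasurable, Θ, hΘ, fun x hx => ?_⟩
  have hK := posDef_of_mem_setH hγ1 hΘs hx
  set P := multivariateGaussian (affineMean A u) Θ.1 with hP
  set Q := multivariateGaussian (affineMean A u) Θs with hQ
  set f : EuclideanSpace ℝ (Fin d) → ℝ := fun ζ =>
    Real.exp (x.1.ofLp ⬝ᵥ ζ.ofLp + (1 / 2) * (ζ.ofLp ⬝ᵥ x.2.1 *ᵥ ζ.ofLp)) with hf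
  have hfc : Continuous f := continuous_exp_quadratic _ _
  have hf0 : ∀ ζ, 0 ≤ f ζ := fun ζ => (Real.exp_pos _).le
  obtain ⟨hQi, -⟩ := integrable_exp_quadratic_multivariateGaussian hΘs x.2.2 hK (affineMean A u)
    x.1.ofLp
  have hle := lintegral_exp_quadratic_multivariateGaussian_le hΘ_psd hΘ_le x.2.2
    (affineMean A u) x.1.ofLp
  rw [add_sub_cancel, ← hP, ← hQ] at hle
  set c := (1 / 2) * ((Θs - Θ.1) * x.2.1).trace with hc
  have hQtop : ∫⁻ ζ, ENNReal.ofReal (f ζ) ∂Q ≠ ⊤ :=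
    ((hasFiniteIntegral_iff_ofReal (ae_of_all _ hf0)).1 hQi.2).ne
  have hc0 : ENNReal.ofReal (Real.exp c) ≠ 0 := by simp [Real.exp_pos]
  -- Integrability under Θ is inherited from Θ⋆ through the same comparison, stated for extended
  -- nonnegative integrals.
  have hPtop : ∫⁻ ζ, ENNReal.ofReal (f ζ) ∂P < ⊤ := by
    rw [lt_top_iff_ne_top]
    intro htop
    have : (⊤ : ENNReal) ≤ ∫⁻ ζ, ENNReal.ofReal (f ζ) ∂Q := by
      refine le_trans (le_of_eq ?_) hle
      simp only [hf] at htop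
      rw [htop, ENNReal.top_mul hc0]
    exact hQtop (top_le_iff.1 this)
  have hPi : Integrable f P :=
    ⟨hfc.aestronglyMeasurable, (hasFiniteIntegral_iff_ofReal (ae_of_all _ hf0)).2 hPtop⟩
  have hint : (∫ ζ, f ζ ∂P) * Real.exp c ≤ ∫ ζ, f ζ ∂Q := by
    rw [integral_eq_lintegral_of_nonneg_ae (ae_of_all _ hf0) hfc.aestronglyMeasurable,
      integral_eq_lintegral_of_nonneg_ae (ae_of_all _ hf0) hfc.aestronglyMeasurable,
      ← ENNReal.toReal_ofReal (Real.exp_pos c).le, ← ENNReal.toReal_mul]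
    exact ENNReal.toReal_mono hQtop hle
  have hexp : Continuous fun ω : Obs d => Real.exp (pairing d x ω) :=
    Real.continuous_exp.comp (LinearMap.continuous_of_finiteDimensional _)
  have hcomp : ∀ ζ : EuclideanSpace ℝ (Fin d),
      Real.exp (pairing d x (ζ, outer ζ.ofLp)) = f ζ := fun ζ => by rw [pairing_outer]
  constructor
  · rw [liftedLaw, integrable_map_measure hexp.aestronglyMeasurable hmeas.aemeasurable]
    simp only [Function.comp_def, hcomp]
    exact hPi
  · rw [liftedLaw, integral_map hmeas.aemeasurable hexp.aestronglyMeasurable]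
    simp only [hcomp]
    have hPpos : 0 < ∫ ζ, f ζ ∂P := integral_exp_pos hPi
    have hlog := Real.log_le_log (mul_pos hPpos (Real.exp_pos c)) hint
    rw [Real.log_mul hPpos.ne' (Real.exp_pos c).ne', Real.log_exp,
      log_integral_exp_quadratic hΘs hK] at hlog
    have hΓ := quadratic_le_gammaZ (Θs := Θs) A h𝒵_compact hu x
    have hF : 0 ≤ δ * (2 - δ) / (2 * (1 - γ)) *
        frobNorm (CFC.sqrt Θs * x.2.1 * CFC.sqrt Θs) ^ 2 :=
      mul_nonneg (div_nonneg (mul_nonneg hδ0 (by linarith)) (by linarith)) (sq_nonneg _)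
    have hce : (1 / 2) * ((Θ.1 - Θs) * x.2.1).trace = -c := by
      rw [hc, Matrix.sub_mul, Matrix.sub_mul, Matrix.trace_sub, Matrix.trace_sub]
      ring
    rw [Phi, hce]
    simp only [affineMean] at hlog
    linarith

/-! ### Coercivity -/

/-- A quadratic lower bound for `Φ`. -/
theorem exists_quadratic_le_Phi {γ δ : ℝ} (hγ1 : γ < 1) (hδ0 : 0 ≤ δ) (hδ2 : δ ≤ 2)
    {Θs : Matrix (Fin d) (Fin d) ℝ} (hΘs : Θs.PosDef) (A : Matrix (Fin d) (Fin m ⊕ Unit) ℝ)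
    {𝒵 : Set (SymMat (Fin m ⊕ Unit))} (h𝒵_compact : IsCompact 𝒵)
    {u : EuclideanSpace ℝ (Fin m)} (hu : outer (aug u) ∈ 𝒵) (Θ : SymMat (Fin d)) :
    ∃ α β κ : ℝ, 0 < α ∧ ∀ x ∈ setH γ Θs,
      α * ‖x.1‖ ^ 2 - β * ‖x.1‖ - κ ≤ Phi A Θs 𝒵 γ δ x Θ := by
  obtain ⟨C, hC0, hC⟩ := exists_abs_le_of_mem_setH γ hΘs
  obtain ⟨p, hp0, hp⟩ : ∃ p : ℝ, 0 ≤ p ∧ ∀ i j, |Θs⁻¹ i j| ≤ p :=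
    ⟨∑ i, ∑ j, |Θs⁻¹ i j|, by positivity, fun i j =>
      (Finset.single_le_sum (f := fun j => |Θs⁻¹ i j|) (fun j _ => abs_nonneg _)
        (Finset.mem_univ j)).trans (Finset.single_le_sum (f := fun i => ∑ j, |Θs⁻¹ i j|)
        (fun i _ => by positivity) (Finset.mem_univ i))⟩
  have hΓ := quadratic_le_gammaZ (Θs := Θs) A h𝒵_compact hu
  generalize A *ᵥ aug u = μ at hΓ
  obtain ⟨s, hs0, hs⟩ : ∃ s : ℝ, 0 ≤ s ∧ ∑ i, |μ i| = s := ⟨_, by positivity, rfl⟩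
  -- On ℋ_γ, hᵀKh ≤ (p + C)d²‖h‖², so this t gives t²hᵀKh ≤ t‖h‖². The added 1 keeps t positive when
  -- (p + C)d² = 0.
  obtain ⟨t, ht0, ht1⟩ : ∃ t : ℝ, 0 < t ∧ t * ((p + C) * (d * d)) ≤ 1 := by
    have hq : 0 ≤ (p + C) * ((d : ℝ) * d) := by positivity
    refine ⟨((p + C) * (d * d) + 1)⁻¹, by positivity, ?_⟩
    rw [inv_mul_le_iff₀ (by linarith)]
    linarith
  refine ⟨t / 2, d * s + t * (C * d * s), (1 / 2) * (C * ∑ i, ∑ j, |Θ.1 i j|) +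
    (1 / 2) * (C * s * s), by positivity, fun x hx => ?_⟩
  have hK := posDef_of_mem_setH hγ1 hΘs hx
  have hH := hC x hx
  have hΓ := hΓ x
  have hsum : ∑ i, |x.1.ofLp i| ≤ d * ‖x.1‖ := by simpa using EuclideanSpace.sum_abs_le x.1
  have hsq : x.1.ofLp ⬝ᵥ x.1.ofLp = ‖x.1‖ ^ 2 := by
    rw [EuclideanSpace.real_norm_sq_eq, dotProduct]
    exact Finset.sum_congr rfl fun i _ => (sq _).symm
  have hr0 : 0 ≤ ‖x.1‖ := norm_nonneg _
  rw [Phi]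
  generalize ‖x.1‖ = r at *
  generalize x.1.ofLp = h at *
  generalize x.2.1 = H at *
  generalize gammaZ A Θs 𝒵 x = G at *
  have hsum0 : 0 ≤ ∑ i, |h i| := by positivity
  have b1 : |h ⬝ᵥ μ| ≤ d * r * s := by
    have := Matrix.abs_dotProduct_mulVec_le (M := (1 : Matrix (Fin d) (Fin d) ℝ)) (C := 1)
      (fun i j => by rw [Matrix.one_apply]; split_ifs <;> simp) h μ
    rw [one_mulVec, one_mul, hs] at this
    exact this.trans (mul_le_mul_of_nonneg_right hsum hs0)
  have b2 : |h ⬝ᵥ H *ᵥ μ| ≤ C * (d * r) * s :=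
    (Matrix.abs_dotProduct_mulVec_le hH h μ).trans (by rw [hs]; gcongr)
  have b3 : |μ ⬝ᵥ H *ᵥ μ| ≤ C * s * s := by
    simpa only [hs] using Matrix.abs_dotProduct_mulVec_le hH μ μ
  have b4 : |h ⬝ᵥ (Θs⁻¹ - H) *ᵥ h| ≤ (p + C) * (d * r) * (d * r) := by
    refine (Matrix.abs_dotProduct_mulVec_le (C := p + C) (fun i j => ?_) h h).trans (by gcongr)
    rw [Matrix.sub_apply]
    exact (abs_sub _ _).trans (add_le_add (hp i j) (hH i j))
  have b5 : |(Θ.1 * H).trace| ≤ C * ∑ i, ∑ j, |Θ.1 i j| := Matrix.abs_trace_mul_le hH _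
  -- The test vector th yields 2t‖h‖² - t²hᵀKh ≥ t‖h‖², up to a term linear in h.
  have hv := hK.le_dotProduct_inv_mulVec (h + H *ᵥ μ) (t • h)
  simp only [mulVec_smul, dotProduct_smul, smul_dotProduct, dotProduct_add, smul_eq_mul] at hv
  rw [hsq] at hv
  -- This gives -½ ln Det ≥ ½Tr(Θ⋆H), which cancels the -½Tr(Θ⋆H) in Φ and leaves the bounded term
  -- ½Tr(ΘH).
  have hlog := (hΘs.posDef_one_sub_sqrt_mul_mul_sqrt hK).log_det_le_trace
  rw [Matrix.trace_sub, Matrix.trace_one, Matrix.trace_mul_comm, ← Matrix.mul_assoc,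
    CFC.sqrt_mul_sqrt_self _ hΘs.posSemidef.nonneg] at hlog
  have hF : 0 ≤ δ * (2 - δ) / (2 * (1 - γ)) * frobNorm (CFC.sqrt Θs * H * CFC.sqrt Θs) ^ 2 :=
    mul_nonneg (div_nonneg (mul_nonneg hδ0 (by linarith)) (by linarith)) (sq_nonneg _)
  have b6 : t * (t * (h ⬝ᵥ (Θs⁻¹ - H) *ᵥ h)) ≤ t * r ^ 2 := by
    have h1 : t * (h ⬝ᵥ (Θs⁻¹ - H) *ᵥ h) ≤ r ^ 2 := by
      calc t * (h ⬝ᵥ (Θs⁻¹ - H) *ᵥ h) ≤ t * ((p + C) * (d * r) * (d * r)) :=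
            mul_le_mul_of_nonneg_left ((le_abs_self _).trans b4) ht0.le
        _ = t * ((p + C) * (d * d)) * r ^ 2 := by ring
        _ ≤ 1 * r ^ 2 := mul_le_mul_of_nonneg_right ht1 (sq_nonneg _)
        _ = r ^ 2 := one_mul _
    exact mul_le_mul_of_nonneg_left h1 ht0.le
  have b7 : -(t * (C * (d * r) * s)) ≤ t * (h ⬝ᵥ H *ᵥ μ) := by
    rw [← mul_neg]
    exact mul_le_mul_of_nonneg_left (abs_le.1 b2).1 ht0.le
  have b1' := (abs_le.1 b1).1
  have b3' := (abs_le.1 b3).1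
  have b5' := (abs_le.1 b5).1
  rw [Matrix.sub_mul, Matrix.trace_sub]
  linarith

theorem tendsto_Phi_atTop {γ δ : ℝ} (hγ1 : γ < 1) (hδ0 : 0 ≤ δ) (hδ2 : δ ≤ 2)
    {Θs : Matrix (Fin d) (Fin d) ℝ} (hΘs : Θs.PosDef) (A : Matrix (Fin d) (Fin m ⊕ Unit) ℝ)
    {𝒵 : Set (SymMat (Fin m ⊕ Unit))} (h𝒵_compact : IsCompact 𝒵)
    {u : EuclideanSpace ℝ (Fin m)} (hu : outer (aug u) ∈ 𝒵) (Θ : SymMat (Fin d)) {x : ℕ → Obs d}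
    (hx : ∀ i, x i ∈ setH γ Θs)
    (hlim : Tendsto (fun i => √(‖(x i).1‖ ^ 2 + frobNorm (x i).2.1 ^ 2)) atTop atTop) :
    Tendsto (fun i => Phi A Θs 𝒵 γ δ (x i) Θ) atTop atTop := by
  obtain ⟨α, β, κ, hα, hΦ⟩ := exists_quadratic_le_Phi (δ := δ) hγ1 hδ0 hδ2 hΘs A h𝒵_compact hu Θ
  obtain ⟨C, hC0, hC⟩ := exists_abs_le_of_mem_setH γ hΘs
  have hfrob : ∀ i, frobNorm (x i).2.1 ≤ d * C := by
    intro i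
    refine abs_le_of_sq_le_sq' ?_ (by positivity) |>.2
    rw [frobNorm_sq]
    calc ∑ k, ∑ l, (x i).2.1 k l ^ 2 ≤ ∑ _k : Fin d, ∑ _l : Fin d, C ^ 2 :=
          Finset.sum_le_sum fun k _ => Finset.sum_le_sum fun l _ =>
            sq_le_sq' (abs_le.1 (hC _ (hx i) k l)).1 (abs_le.1 (hC _ (hx i) k l)).2
      _ = (d * C) ^ 2 := by simp; ring
  -- The Frobenius norm of H is at most dC, so divergence of the full norm forces ‖h‖ to infinity.
  have hr : Tendsto (fun i => ‖(x i).1‖) atTop atTop := by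
    refine tendsto_atTop_mono (fun i => ?_) (tendsto_atTop_add_const_right _ (-(d * C)) hlim)
    have hf0 : 0 ≤ frobNorm (x i).2.1 := Real.sqrt_nonneg _
    have : √(‖(x i).1‖ ^ 2 + frobNorm (x i).2.1 ^ 2) ≤ ‖(x i).1‖ + frobNorm (x i).2.1 := by
      rw [Real.sqrt_le_left (by positivity)]
      nlinarith [mul_nonneg (norm_nonneg (x i).1) hf0]
    linarith [hfrob i]
  have hq : Tendsto (fun r : ℝ => α * r ^ 2 - β * r - κ) atTop atTop := by
    have : (fun r : ℝ => α * r ^ 2 - β * r - κ) = fun r => r * (α * r + -β) + -κ := by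
      ext r
      ring
    rw [this]
    exact tendsto_atTop_add_const_right _ _ (tendsto_id.atTop_mul_atTop₀
      (tendsto_atTop_add_const_right _ _ (tendsto_id.const_mul_atTop hα)))
  exact tendsto_atTop_mono (fun i => hΦ _ (hx i)) (hq.comp hr)

end GaussLift

theorem mainTheorem4 {d m : ℕ}
    (U : Set (EuclideanSpace ℝ (Fin m))) (hU_ne : U.Nonempty) (hU_bdd : Bornology.IsBounded U)
    (𝒰 : Set (SymMat (Fin d))) (h𝒰_ne : 𝒰.Nonempty) (h𝒰_convex : Convex ℝ 𝒰)
    (h𝒰_compact : IsCompact 𝒰) (h𝒰_psd : ∀ Θ ∈ 𝒰, Θ.1.PosSemidef)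
    (Θs : Matrix (Fin d) (Fin d) ℝ) (hΘs : Θs.PosDef)
    (hΘs_ub : ∀ Θ ∈ 𝒰, (Θs - Θ.1).PosSemidef)
    (A : Matrix (Fin d) (Fin m ⊕ Unit) ℝ)
    (δ : ℝ) (hδ0 : 0 ≤ δ) (hδ2 : δ ≤ 2)
    (hδ : ∀ Θ ∈ 𝒰, specNorm (CFC.sqrt Θ.1 * (CFC.sqrt Θs)⁻¹ - 1) ≤ δ)
    (γ : ℝ) (hγ0 : 0 < γ) (hγ1 : γ < 1)
    (𝒵 : Set (SymMat (Fin m ⊕ Unit))) (h𝒵_convex : Convex ℝ 𝒵) (h𝒵_compact : IsCompact 𝒵)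
    (h𝒵_psd : ∀ W ∈ 𝒵, W.1.PosSemidef ∧ W.1 (Sum.inr ()) (Sum.inr ()) = 1)
    (h𝒵_mem : ∀ u ∈ U, outer (GaussLift.aug u) ∈ 𝒵) :
    IsRegularData (GaussLift.setH γ Θs) 𝒰 (GaussLift.Phi A Θs 𝒵 γ δ) ∧
    GaussLift.liftedFamily A U 𝒰 ⊆
      simpleFamily (GaussLift.pairing d) (GaussLift.setH γ Θs) 𝒰 (GaussLift.Phi A Θs 𝒵 γ δ) ∧
    (∀ Θ ∈ 𝒰, ∀ x : ℕ → GaussLift.Obs d, (∀ i, x i ∈ GaussLift.setH γ Θs) →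
      Tendsto (fun i => √(‖(x i).1‖ ^ 2 + frobNorm (x i).2.1 ^ 2)) atTop atTop →
      Tendsto (fun i => GaussLift.Phi A Θs 𝒵 γ δ (x i) Θ) atTop atTop) := by
  obtain ⟨u₀, hu₀⟩ := hU_ne
  have hne : 𝒵.Nonempty := ⟨_, h𝒵_mem u₀ hu₀⟩
  have hpsd : ∀ W ∈ 𝒵, W.1.PosSemidef := fun W hW => (h𝒵_psd W hW).1
  refine ⟨⟨GaussLift.nonempty_setH hγ0 hΘs, GaussLift.isClosed_setH γ hΘs,
    GaussLift.convex_setH γ Θs, fun _ hx => GaussLift.neg_mem_setH hx, h𝒰_compact.isClosed,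
    h𝒰_convex, GaussLift.continuousOn_Phi hγ1 hΘs A h𝒵_compact 𝒰,
    fun Θ _ => GaussLift.convexOn_Phi hγ1 hδ0 hδ2 hΘs A h𝒵_compact hne hpsd Θ,
    fun x _ => GaussLift.concaveOn_Phi A h𝒰_convex x⟩, ?_, ?_⟩
  · rintro _ ⟨u, hu, Θ, hΘ, rfl⟩
    exact GaussLift.liftedLaw_mem_simpleFamily hγ1 hδ0 hδ2 hΘs A h𝒵_compact (h𝒵_mem u hu) hΘ
      (h𝒰_psd Θ hΘ) (hΘs_ub Θ hΘ)
  · intro Θ _ x hx hlim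
    exact GaussLift.tendsto_Phi_atTop hγ1 hδ0 hδ2 hΘs A h𝒵_compact (h𝒵_mem u₀ hu₀) Θ hx hlim
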